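/- Let $d\gamma(z)=\frac1\pi d^2z$ on $\mathbb C$. For $N\ge 1$ (real) let $\mathcal B_N\subset L^2(\mathbb C,\gamma)$ be the Fock–Bargmann space of the $u\in L^2(\mathbb C,\gamma)$ of the form $u(z)=g(z)e^{-N|z|^2/2}$ with $g$ entire, and let $P_N$ be the orthogonal projection onto $\mathcal B_N$, whose integral kernel is $P_N(x,z)=N\exp\big(N(x\bar z-|x|^2/2-|z|^2/2)\big)$. Let $V:\mathbb C\to(0,\infty)$ be such that $\log V$ is Lipschitz continuous on $\mathbb C$. Let $H_N=P_NVP_N$, acting on $\mathcal B_N$ with domain $\{u\in\mathcal B_N: Vu\in L^2(\mathbb C,\gamma)\}$, and let $\Pi_N=\mathbf 1\{H_N\le\mu\}$ be its spectral projection on $\mathcal B_N$, extended by $0$ on $\mathcal B_N^\perp$. Write $\Pi_N(x,z)$ for its continuous integral kernel with respect to $\gamma$. Let $\mu>\min V$. For every $\alpha>0$ and every $\delta>0$ such that $\{V\le\mu(1+\delta)\}$ is compact, there exists $N_0=N_0(V,\mu,\delta,\alpha)\ge1$ such that for every real $N\ge N_0$ the operator $H_N$ is self-adjoint, $\Pi_N$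 has a continuous integral kernel, and for all $x,z\in\mathbb C$ $$|\Pi_N(x,z)|\le N\exp\Big(-\alpha\sqrt N\,\big[\mathrm{dist}(x,\{V\le\mu+\delta\})+\mathrm{dist}(z,\{V\le\mu+\delta\})\big]\Big),$$ $$|\Pi_N(x,z)-P_N(x,z)|\le N\exp\Big(-\alpha\sqrt N\,\big[\mathrm{dist}(x,\{V\ge\mu-\delta\})+\mathrm{dist}(z,\{V\ge\mu-\delta\})\big]\Big).$$ -/

import Mathlib

open MeasureTheory Filter Topology
open scoped ENNReal InnerProductSpace

namespace BerezinToeplitz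

noncomputable section

/-- The reference measure `dγ(z) = π⁻¹ d²z` on `ℂ`. -/
def planeMeasure : Measure ℂ := ENNReal.ofReal (Real.pi⁻¹) • volume

/-- The Hilbert space `L²(ℂ, γ)`. -/
abbrev PlaneL2 : Type := Lp ℂ 2 planeMeasure

lemma planeMeasure_ball (w : ℂ) : planeMeasure (Metric.ball w 1) = 1 := by
  simp only [planeMeasure, Measure.smul_apply, Complex.volume_ball, smul_eq_mul]
  rw [ENNReal.ofReal_inv_of_pos Real.pi_pos]
  simp only [ENNReal.ofReal_one, one_pow, one_mul]
  have : ENNReal.ofReal Real.pi = (NNReal.pi : ℝ≥0∞) := by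
    rw [ENNReal.ofReal, ← NNReal.coe_real_pi, Real.toNNReal_coe]
  rw [this]
  exact ENNReal.inv_mul_cancel (by simpa using NNReal.pi_ne_zero) ENNReal.coe_ne_top

lemma setIntegral_ball_of_entire {g : ℂ → ℂ} (hg : Differentiable ℂ g) (w : ℂ) :
    ∫ z in Metric.ball w 1, g z ∂planeMeasure = g w := by
  have key : ∫ z in Metric.ball w 1, g z = (Real.pi : ℂ) * g w := by
    have h1 : ∫ z in Metric.ball w 1, g z
        = ∫ z, (Metric.ball (0 : ℂ) 1).indicator (fun z => g (w + z)) z := by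
      rw [← integral_indicator measurableSet_ball,
        ← integral_add_left_eq_self _ w]
      congr 1
      ext z
      simp [Set.indicator]
    rw [h1, ← Complex.integral_comp_polarCoord_symm]
    have h2 : ∀ p ∈ polarCoord.target,
        p.1 • (Metric.ball (0 : ℂ) 1).indicator (fun z => g (w + z)) (Complex.polarCoord.symm p)
        = (Set.Iio (1 : ℝ) ×ˢ (Set.univ : Set ℝ)).indicator
            (fun p : ℝ × ℝ => (p.1 : ℂ) * g (circleMap w p.1 p.2)) p := by
      rintro ⟨r, θ⟩ hp
      have hr : 0 < r := hp.1
      by_cases hr1 : r < 1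
      · have hm : Complex.polarCoord.symm (r, θ) ∈ Metric.ball (0 : ℂ) 1 := by
          rw [mem_ball_zero_iff, Complex.norm_polarCoord_symm, abs_of_pos hr]; exact hr1
        rw [Set.indicator_of_mem hm, Set.indicator_of_mem (by simpa using hr1)]
        simp only [Complex.real_smul, circleMap, Complex.polarCoord_symm_apply]
        rw [Complex.exp_mul_I, Complex.ofReal_cos, Complex.ofReal_sin]
      · have hm : Complex.polarCoord.symm (r, θ) ∉ Metric.ball (0 : ℂ) 1 := by
          rw [mem_ball_zero_iff, Complex.norm_polarCoord_symm, abs_of_pos hr]; exact hr1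
        rw [Set.indicator_of_notMem hm, Set.indicator_of_notMem (by simpa using hr1)]
        simp
    rw [setIntegral_congr_fun polarCoord.open_target.measurableSet h2,
      setIntegral_indicator (measurableSet_Iio.prod MeasurableSet.univ)]
    have h3 : polarCoord.target ∩ (Set.Iio (1 : ℝ) ×ˢ (Set.univ : Set ℝ))
        = Set.Ioo (0 : ℝ) 1 ×ˢ Set.Ioo (-Real.pi) Real.pi := by
      ext ⟨r, θ⟩
      simp [polarCoord]
      tauto
    rw [h3, Measure.volume_eq_prod, setIntegral_prod]
    · have h4 : ∀ r ∈ Set.Ioo (0 : ℝ) 1,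
          ∫ θ in Set.Ioo (-Real.pi) Real.pi, (r : ℂ) * g (circleMap w r θ)
          = ((2 * Real.pi * r : ℝ) : ℂ) * g w := by
        intro r _
        have hc : Real.circleAverage g w r = g w :=
          DiffContOnCl.circleAverage hg.diffContOnCl
        rw [integral_const_mul, ← integral_Ioc_eq_integral_Ioo,
          ← intervalIntegral.integral_of_le (by linarith [Real.pi_pos])]
        have hper : Function.Periodic (fun θ => g (circleMap w r θ)) (2 * Real.pi) := by
          intro θ
          simp [periodic_circleMap w r θ]
        have := hper.intervalIntegral_add_eq (-Real.pi) 0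
        rw [show -Real.pi + 2 * Real.pi = Real.pi by ring, zero_add] at this
        rw [this]
        rw [Real.circleAverage_def] at hc
        rw [← hc, Complex.real_smul]
        have := Real.pi_ne_zero
        push_cast
        have : (Real.pi : ℂ) ≠ 0 := by exact_mod_cast this
        field_simp
      rw [setIntegral_congr_fun measurableSet_Ioo h4, integral_mul_const]
      congr 1
      rw [integral_complex_ofReal, ← integral_Ioc_eq_integral_Ioo,
        ← intervalIntegral.integral_of_le zero_le_one, intervalIntegral.integral_const_mul,
        integral_id]
      push_cast
      ring
    · have hcont : Continuous fun p : ℝ × ℝ => (p.1 : ℂ) * g (circleMap w p.1 p.2) := by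
        have := hg.continuous
        unfold circleMap
        fun_prop
      exact (hcont.continuousOn.integrableOn_compact
        (isCompact_Icc.prod isCompact_Icc)).mono_set
        (Set.prod_mono Set.Ioo_subset_Icc_self Set.Ioo_subset_Icc_self)
  rw [planeMeasure, Measure.restrict_smul, integral_smul_measure, key,
    ENNReal.toReal_ofReal (by positivity), Complex.real_smul]
  have : (Real.pi : ℂ) ≠ 0 := by exact_mod_cast Real.pi_ne_zero
  push_cast
  field_simp

/-- The Fock--Bargmann space `𝓑_N`: the `u ∈ L²(ℂ, γ)` of the form `u(z) = g(z) exp(-N|z|²/2)`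
with `g` entire. -/
def fock (N : ℝ) : Submodule ℂ PlaneL2 where
  carrier := {u | ∃ g : ℂ → ℂ, Differentiable ℂ g ∧
    u =ᵐ[planeMeasure] fun z => g z * (Real.exp (-N * ‖z‖ ^ 2 / 2) : ℂ)}
  zero_mem' := ⟨0, differentiable_const 0, by
    filter_upwards [Lp.coeFn_zero ℂ 2 planeMeasure] with z hz
    rw [hz]
    simp⟩
  add_mem' := by
    rintro u v ⟨g, hg, hu⟩ ⟨h, hh, hv⟩
    refine ⟨fun z => g z + h z, hg.add hh, ?_⟩
    filter_upwards [Lp.coeFn_add u v, hu, hv] with z hz h1 h2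
    rw [hz, Pi.add_apply, h1, h2]
    ring
  smul_mem' := by
    rintro c u ⟨g, hg, hu⟩
    refine ⟨fun z => c * g z, hg.const_mul c, ?_⟩
    filter_upwards [Lp.coeFn_smul c u, hu] with z hz h1
    rw [hz, Pi.smul_apply, h1, smul_eq_mul]
    ring

lemma memLp_ballWeight (N : ℝ) (w : ℂ) :
    MemLp ((Metric.ball w 1).indicator fun z => (Real.exp (N * ‖z‖ ^ 2 / 2) : ℂ))
      2 planeMeasure ∧
    eLpNorm ((Metric.ball w 1).indicator fun z => (Real.exp (N * ‖z‖ ^ 2 / 2) : ℂ))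
      2 planeMeasure ≤ ENNReal.ofReal (Real.exp (|N| * (‖w‖ + 1) ^ 2 / 2)) := by
  have hb : eLpNorm ((Metric.ball w 1).indicator
      fun z => (Real.exp (N * ‖z‖ ^ 2 / 2) : ℂ)) 2 planeMeasure
      ≤ ENNReal.ofReal (Real.exp (|N| * (‖w‖ + 1) ^ 2 / 2)) := by
    rw [eLpNorm_indicator_eq_eLpNorm_restrict measurableSet_ball]
    refine (eLpNorm_le_of_ae_bound (C := Real.exp (|N| * (‖w‖ + 1) ^ 2 / 2)) ?_).trans ?_
    · filter_upwards [ae_restrict_mem measurableSet_ball] with z hz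
      rw [Complex.norm_real, Real.norm_eq_abs, Real.abs_exp]
      apply Real.exp_le_exp.2
      have h1 : ‖z‖ ≤ ‖w‖ + 1 := by
        have := norm_sub_norm_le z w
        rw [mem_ball_iff_norm] at hz
        linarith
      have h2 : ‖z‖ ^ 2 ≤ (‖w‖ + 1) ^ 2 := by gcongr
      have h3 : N * ‖z‖ ^ 2 ≤ |N| * ‖z‖ ^ 2 := by gcongr; exact le_abs_self N
      have h4 : |N| * ‖z‖ ^ 2 ≤ |N| * (‖w‖ + 1) ^ 2 := by gcongr
      linarith
    · simp [planeMeasure_ball]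
  refine ⟨⟨?_, hb.trans_lt ENNReal.ofReal_lt_top⟩, hb⟩
  have : Continuous fun z : ℂ => (Real.exp (N * ‖z‖ ^ 2 / 2) : ℂ) := by fun_prop
  exact this.aestronglyMeasurable.indicator measurableSet_ball

lemma inner_ballWeight (N : ℝ) (w : ℂ) {u : PlaneL2} {g : ℂ → ℂ} (hg : Differentiable ℂ g)
    (hu : u =ᵐ[planeMeasure] fun z => g z * (Real.exp (-N * ‖z‖ ^ 2 / 2) : ℂ)) :
    ⟪(memLp_ballWeight N w).1.toLp, u⟫_ℂ = g w := by
  rw [L2.inner_def, ← setIntegral_ball_of_entire hg w, ← integral_indicator measurableSet_ball]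
  apply integral_congr_ae
  filter_upwards [(memLp_ballWeight N w).1.coeFn_toLp, hu] with z h1 h2
  rw [h1, h2]
  by_cases hz : z ∈ Metric.ball w 1
  · rw [Set.indicator_of_mem hz, Set.indicator_of_mem hz, RCLike.inner_apply, Complex.conj_ofReal,
      mul_assoc, ← Complex.ofReal_mul, ← Real.exp_add]
    ring_nf
    simp
  · simp [Set.indicator_of_notMem hz]

lemma isClosed_fock (N : ℝ) : IsClosed (fock N : Set PlaneL2) := by
  apply IsSeqClosed.isClosed
  intro u v hu huv
  choose g hg hug using hu
  set k : ℂ → PlaneL2 := fun w => (memLp_ballWeight N w).1.toLp with hk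
  set G : ℂ → ℂ := fun w => ⟪k w, v⟫_ℂ with hG
  have hdiff : ∀ n w, ‖G w - g n w‖ ≤ Real.exp (|N| * (‖w‖ + 1) ^ 2 / 2) * ‖v - u n‖ := by
    intro n w
    rw [← inner_ballWeight N w (hg n) (hug n), hG, ← inner_sub_right]
    refine (norm_inner_le_norm _ _).trans ?_
    gcongr
    rw [Lp.norm_toLp]
    exact ENNReal.toReal_le_of_le_ofReal (Real.exp_pos _).le (memLp_ballWeight N w).2
  have h0 : Tendsto (fun n => ‖v - u n‖) atTop (𝓝 0) := by
    simpa using (tendsto_const_nhds (x := v)).sub huv |>.norm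
  have hloc : TendstoLocallyUniformlyOn g G atTop Set.univ := by
    rw [tendstoLocallyUniformlyOn_iff_forall_isCompact isOpen_univ]
    intro K _ hK
    obtain ⟨R, hR⟩ := hK.isBounded.exists_norm_le
    rw [Metric.tendstoUniformlyOn_iff]
    intro ε hε
    have h1 : Tendsto (fun n => Real.exp (|N| * (|R| + 1) ^ 2 / 2) * ‖v - u n‖) atTop (𝓝 0) := by
      simpa using h0.const_mul (Real.exp (|N| * (|R| + 1) ^ 2 / 2))
    filter_upwards [h1.eventually (gt_mem_nhds hε)] with n hn w hw
    rw [dist_eq_norm]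
    refine (hdiff n w).trans_lt (lt_of_le_of_lt ?_ hn)
    have := (hR w hw).trans (le_abs_self R)
    gcongr
  have hGd : Differentiable ℂ G := by
    rw [← differentiableOn_univ]
    exact hloc.differentiableOn (Eventually.of_forall fun n => (hg n).differentiableOn) isOpen_univ
  refine ⟨G, hGd, ?_⟩
  obtain ⟨ns, hns, hae⟩ := (tendstoInMeasure_of_tendsto_Lp huv).exists_seq_tendsto_ae
  filter_upwards [hae, ae_all_iff.2 hug] with z h1 h2
  have h3 : Tendsto (fun i => g (ns i) z) atTop (𝓝 (G z)) :=
    (hloc.tendsto_at (Set.mem_univ z)).comp hns.tendsto_atTop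
  simp only [h2] at h1
  exact tendsto_nhds_unique h1 (h3.mul_const _)

instance (N : ℝ) : CompleteSpace (fock N) := (isClosed_fock N).completeSpace_coe

/-- Multiplication by `V` on `L²(ℂ, γ)`, with its maximal domain `{u | V u ∈ L²(ℂ, γ)}`. -/
def mulOp (V : ℂ → ℝ) : PlaneL2 →ₗ.[ℂ] PlaneL2 where
  domain :=
    { carrier := {u | MemLp (fun z => (V z : ℂ) * u z) 2 planeMeasure}
      zero_mem' := by
        refine MemLp.ae_eq ?_ (MemLp.zero (ε := ℂ))
        filter_upwards [Lp.coeFn_zero ℂ 2 planeMeasure] with z hz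
        rw [hz]
        simp
      add_mem' := by
        intro u v hu hv
        refine MemLp.ae_eq ?_ (MemLp.add hu hv)
        filter_upwards [Lp.coeFn_add u v] with z hz
        rw [hz, Pi.add_apply, Pi.add_apply, mul_add]
      smul_mem' := by
        intro c u hu
        refine MemLp.ae_eq ?_ (MemLp.const_smul hu c)
        filter_upwards [Lp.coeFn_smul c u] with z hz
        rw [hz, Pi.smul_apply, Pi.smul_apply, smul_eq_mul, smul_eq_mul]
        ring }
  toFun :=
    { toFun := fun u => MemLp.toLp (fun z => (V z : ℂ) * (u : PlaneL2) z) u.2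
      map_add' := by
        intro u v
        rw [← MemLp.toLp_add, MemLp.toLp_eq_toLp_iff]
        filter_upwards [Lp.coeFn_add (u : PlaneL2) (v : PlaneL2)] with z hz
        rw [Submodule.coe_add, hz, Pi.add_apply, Pi.add_apply, mul_add]
      map_smul' := by
        intro c u
        rw [RingHom.id_apply, ← MemLp.toLp_const_smul, MemLp.toLp_eq_toLp_iff]
        filter_upwards [Lp.coeFn_smul c (u : PlaneL2)] with z hz
        rw [Submodule.coe_smul, hz, Pi.smul_apply, Pi.smul_apply, smul_eq_mul, smul_eq_mul]
        ring }

/-- The operator `H_N = P_N V P_N` on the Fock--Bargmann space, where `P_N` is the orthogonal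
projection of `L²(ℂ, γ)` onto `𝓑_N`: its domain is `{u ∈ 𝓑_N : V u ∈ L²(ℂ, γ)}`, and
`H_N u = P_N (V u)`. -/
def toeplitz (N : ℝ) (V : ℂ → ℝ) : fock N →ₗ.[ℂ] fock N where
  domain := (mulOp V).domain.comap (fock N).subtype
  toFun := (fock N).orthogonalProjectionOnto.toLinearMap ∘ₗ (mulOp V).toFun ∘ₗ
    (fock N).subtype.restrict fun _ hu => hu

section SpectralProjection

variable {E : Type*} [NormedAddCommGroup E] [InnerProductSpace ℂ E] [CompleteSpace E]

/-- `R` is the bounded two-sided inverse of `A + 1`. There is at most one such `R`. -/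
def IsResolventNegOne (A : E →ₗ.[ℂ] E) (R : E →L[ℂ] E) : Prop :=
  (∀ x : E, ∃ hx : R x ∈ A.domain, A ⟨R x, hx⟩ + R x = x) ∧
    ∀ y : A.domain, R (A y + (y : E)) = y

open Classical in
/-- The bounded operator `(A + 1)⁻¹`; it exists for every nonnegative self-adjoint `A`
(and the value is `0` if there is no bounded inverse). -/
def resolventNegOne (A : E →ₗ.[ℂ] E) : E →L[ℂ] E :=
  if h : ∃ R, IsResolventNegOne A R then h.choose else 0

/-- The range of the spectral projection `𝟏{A ≤ μ}` of a nonnegative self-adjoint, possibly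
unbounded, operator `A`, for `μ ≥ 0`. With `R = (A + 1)⁻¹`, a bounded self-adjoint operator, one has
`𝟏{A ≤ μ} = 𝟏{R ≥ (1 + μ)⁻¹} = 𝟏{f(R) = 0}` for the continuous function
`f(t) = max ((1 + μ)⁻¹ - t) 0`, and the range of `𝟏{f(R) = 0}` is the kernel of `f(R)`. -/
def spectralSubspaceLE (A : E →ₗ.[ℂ] E) (μ : ℝ) : Submodule ℂ E :=
  (cfc (fun t : ℝ => max ((1 + μ)⁻¹ - t) 0) (resolventNegOne A)).ker

instance (A : E →ₗ.[ℂ] E) (μ : ℝ) : CompleteSpace (spectralSubspaceLE A μ) :=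
  ContinuousLinearMap.completeSpace_ker _

end SpectralProjection

/-- The spectral projection `Π_N = 𝟏{H_N ≤ μ}` of `H_N = P_N V P_N` on `𝓑_N`, extended by `0` on the
orthogonal complement of `𝓑_N` to an operator on `L²(ℂ, γ)`. -/
def spectralProjection (N : ℝ) (V : ℂ → ℝ) (μ : ℝ) : PlaneL2 →L[ℂ] PlaneL2 :=
  (fock N).subtypeL ∘L (spectralSubspaceLE (toeplitz N V) μ).starProjection ∘L
    (fock N).orthogonalProjectionOnto

/-- `K` is the continuous integral kernel of `T`: `(T f)(x) = ∫ K(x, z) f(z) dγ(z)`. Since `γ` has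
full support, an operator has at most one continuous integral kernel. -/
structure IsContinuousKernel (T : PlaneL2 →L[ℂ] PlaneL2) (K : ℂ → ℂ → ℂ) : Prop where
  continuous : Continuous fun p : ℂ × ℂ => K p.1 p.2
  memLp : ∀ x, MemLp (K x) 2 planeMeasure
  apply_ae : ∀ f : PlaneL2, T f =ᵐ[planeMeasure] fun x => ∫ z, K x z * f z ∂planeMeasure

/-- The kernel `P_N(x, z) = N exp(N (x z̄ - |x|²/2 - |z|²/2))` of the `∞`-Ginibre process. -/
def ginibreKernel (N : ℝ) (x z : ℂ) : ℂ :=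
  N * Complex.exp (N * (x * (starRingEnd ℂ) z - (‖x‖ : ℂ) ^ 2 / 2 - (‖z‖ : ℂ) ^ 2 / 2))

end

end BerezinToeplitz

/-!
# Exponential decay of spectral projections of Toeplitz operators on the Fock--Bargmann space

Two facts carry the proof. First, `P_N(x, z)` is concentrated at distance `N^(-1/2)` from the
diagonal, a scale on which `V` is nearly constant because `log V` is Lipschitz. Hence the commutator
`[V, P_N]` is of relative size `O(N^(-1/2))`, and this persists after conjugation by a weight
`exp (√N ψ)` with `ψ` Lipschitz (`eLpNorm_weighted_le`, a Schur test, with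
`weighted_kernel_le_of_small`). In particular `P_N (1 + V)⁻¹` inverts `H_N + 1` up to a small error,
so that the bounded resolvent `R = (H_N + 1)⁻¹` exists and `H_N` is self-adjoint
(`exists_isResolventNegOne`, `IsResolventNegOne.isSelfAdjoint`), and `R` is close to multiplication
by `(1 + V)⁻¹` in weighted norms (`norm_weight_resolvent_sub_le`).

Second, a Lyapunov argument (`norm_sq_le_of_lyapunov`) replaces the Agmon estimate for single
eigenfunctions and needs no information on the nature of the spectrum. On the range `X` of `Π_N` one
has `R - (1 + μ)⁻¹ ≥ 0`, whereas, in the weighted norm, `R - (1 + μ)⁻¹` is close to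
`(1 + V)⁻¹ - (1 + μ)⁻¹`, which is negative where the weight is nontrivial, if `ψ` is supported in
`{V > μ + δ/2}`. The two signs force `‖exp (√N ψ) u‖ ≤ C ‖u‖` on `X`. On the orthogonal complement
of `X` in `𝓑_N` both signs are reversed, and the same argument applies to weights supported in
`{V < μ - δ/2}`.

The reproducing property turns this into a pointwise bound on the projection of the coherent state
`k_x = P_N(·, x)`, and `Π_N(x, z) = ⟪Π_N k_x, Π_N k_z⟫`. To obtain the prefactor `N` without
a constant, `ψ` is `α` times the distance to the allowed region plus a cut-off function of `log V`,
which gains a factor `exp (-√N ℓ)` with `ℓ > 0` as soon as the distance is positive. Where it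
vanishes, `‖k_x‖ = √N` suffices.
-/

namespace BerezinToeplitz

noncomputable section

/-! ### Gaussian integrals and coherent states -/

section

lemma planeMeasure_eq_smul : planeMeasure = (Real.pi⁻¹).toNNReal • (volume : Measure ℂ) := rfl

instance : planeMeasure.IsAddHaarMeasure := by
  rw [planeMeasure_eq_smul]
  exact Measure.IsAddHaarMeasure.nnreal_smul _ (by simpa using Real.pi_pos)

lemma integral_planeMeasure {F : Type*} [NormedAddCommGroup F] [NormedSpace ℝ F] (f : ℂ → F) :
    ∫ z, f z ∂planeMeasure = Real.pi⁻¹ • ∫ z, f z := by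
  rw [planeMeasure, integral_smul_measure, ENNReal.toReal_ofReal (by positivity)]

lemma integral_gaussian_planeMeasure {b : ℝ} (hb : 0 < b) :
    ∫ z : ℂ, Real.exp (-b * ‖z‖ ^ 2) ∂planeMeasure = b⁻¹ := by
  rw [integral_planeMeasure, GaussianFourier.integral_rexp_neg_mul_sq_norm hb]
  have := Real.pi_pos
  simp only [Complex.finrank_real_complex, smul_eq_mul]
  norm_num
  field_simp

lemma integrable_gaussian_planeMeasure {b : ℝ} (hb : 0 < b) :
    Integrable (fun z : ℂ => Real.exp (-b * ‖z‖ ^ 2)) planeMeasure := by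
  by_contra h
  have := integral_gaussian_planeMeasure hb
  rw [integral_undef h] at this
  exact (inv_pos.2 hb).ne this

lemma lintegral_gaussian_planeMeasure {b : ℝ} (hb : 0 < b) :
    ∫⁻ z : ℂ, ENNReal.ofReal (Real.exp (-b * ‖z‖ ^ 2)) ∂planeMeasure = ENNReal.ofReal b⁻¹ := by
  rw [← ofReal_integral_eq_lintegral_ofReal (integrable_gaussian_planeMeasure hb)
    (ae_of_all _ fun _ => (Real.exp_pos _).le), integral_gaussian_planeMeasure hb]

variable {N : ℝ}

lemma norm_ginibreKernel (hN : 0 < N) (x z : ℂ) :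
    ‖ginibreKernel N x z‖ = N * Real.exp (-(N / 2) * ‖x - z‖ ^ 2) := by
  rw [ginibreKernel, norm_mul, Complex.norm_exp, Complex.norm_real, Real.norm_eq_abs, abs_of_pos hN]
  congr 2
  rw [Complex.re_ofReal_mul, ← Complex.normSq_eq_norm_sq (x - z), Complex.normSq_sub]
  simp only [Complex.sub_re, ← Complex.ofReal_pow, ← Complex.normSq_eq_norm_sq,
    ← Complex.ofReal_div, ← Complex.ofReal_ofNat, Complex.ofReal_re]
  ring

lemma conj_ginibreKernel (x z : ℂ) :
    (starRingEnd ℂ) (ginibreKernel N x z) = ginibreKernel N z x := by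
  simp only [ginibreKernel, map_mul, Complex.conj_ofReal, ← Complex.exp_conj, map_sub, map_div₀,
    map_pow, Complex.conj_conj, map_ofNat]
  congr 2
  ring

lemma continuous_ginibreKernel_left (x : ℂ) : Continuous fun z => ginibreKernel N z x := by
  unfold ginibreKernel
  fun_prop

lemma memLp_ginibreKernel (hN : 0 < N) (x : ℂ) :
    MemLp (fun z => ginibreKernel N z x) 2 planeMeasure := by
  rw [memLp_two_iff_integrable_sq_norm (continuous_ginibreKernel_left x).aestronglyMeasurable]
  have h := ((integrable_gaussian_planeMeasure hN).comp_sub_right x).const_mul (N ^ 2)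
  refine h.congr (ae_of_all _ fun z => ?_)
  simp only [norm_ginibreKernel hN, mul_pow, ← Real.exp_nat_mul]
  congr 2
  push_cast
  ring

/-- The coherent state at `x`: the function `z ↦ P_N(z, x)`, which represents evaluation at `x` on
the Fock--Bargmann space. -/
def coherent (hN : 0 < N) (x : ℂ) : PlaneL2 := (memLp_ginibreKernel hN x).toLp

lemma coeFn_coherent (hN : 0 < N) (x : ℂ) :
    coherent hN x =ᵐ[planeMeasure] fun z => ginibreKernel N z x := MemLp.coeFn_toLp _

lemma coherent_mem_fock (hN : 0 < N) (x : ℂ) : coherent hN x ∈ fock N := by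
  refine ⟨fun z => N * Complex.exp (N * (z * (starRingEnd ℂ) x - (‖x‖ : ℂ) ^ 2 / 2)),
    by fun_prop, ?_⟩
  filter_upwards [coeFn_coherent hN x] with z hz
  rw [hz, ginibreKernel, mul_assoc, Complex.ofReal_exp, ← Complex.exp_add]
  congr 2
  push_cast
  ring

lemma inner_coherent (hN : 0 < N) (x : ℂ) (u : PlaneL2) :
    ⟪coherent hN x, u⟫_ℂ = ∫ z, ginibreKernel N x z * u z ∂planeMeasure := by
  rw [L2.inner_def]
  apply integral_congr_ae
  filter_upwards [coeFn_coherent hN x] with z hz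
  rw [hz, RCLike.inner_apply, conj_ginibreKernel, mul_comm]

/-- The Gaussian average of an entire function is its value at the origin: by rotation invariance
the function may first be averaged over circles. -/
lemma integral_gaussian_mul_entire (hN : 0 < N) {h : ℂ → ℂ} (hh : Differentiable ℂ h)
    (hint : Integrable (fun y => (Real.exp (-N * ‖y‖ ^ 2) : ℂ) * h y) planeMeasure) :
    ∫ y, (N : ℂ) * ((Real.exp (-N * ‖y‖ ^ 2) : ℂ) * h y) ∂planeMeasure = h 0 := by
  set F : ℂ → ℂ := fun y => (Real.exp (-N * ‖y‖ ^ 2) : ℂ) * h y with hF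
  have hFc : Continuous F := by
    have := hh.continuous
    fun_prop
  have hmp : ∀ θ : ℝ, MeasurePreserving (fun y : ℂ => circleMap 0 1 θ * y)
      planeMeasure planeMeasure := by
    intro θ
    have h1 := (rotation (Circle.exp θ)).measurePreserving
    have h2 : MeasurePreserving (fun y : ℂ => circleMap 0 1 θ * y) volume volume := by
      have hf : (fun y : ℂ => circleMap 0 1 θ * y) = rotation (Circle.exp θ) := by
        ext y
        simp [circleMap]
      rw [hf]
      exact h1
    exact h2.smul_measure _
  have hme : ∀ θ : ℝ, MeasurableEmbedding (fun y : ℂ => circleMap 0 1 θ * y) := fun θ =>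
    (Homeomorph.mulLeft₀ _ (by simp)).measurableEmbedding
  set G : ℝ × ℂ → ℂ := fun p => F (circleMap 0 1 p.1 * p.2) with hG
  have hGc : Continuous G := hFc.comp (by unfold circleMap; fun_prop)
  set ν : Measure ℝ := volume.restrict (Set.Ioc 0 (2 * Real.pi)) with hν
  have hGint : Integrable G (ν.prod planeMeasure) := by
    rw [integrable_prod_iff hGc.aestronglyMeasurable]
    refine ⟨ae_of_all _ fun θ => ((hmp θ).integrable_comp_emb (hme θ)).2 hint, ?_⟩
    have : (fun θ : ℝ => ∫ y, ‖G (θ, y)‖ ∂planeMeasure) = fun _ => ∫ y, ‖F y‖ ∂planeMeasure := by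
      ext θ
      exact (hmp θ).integral_comp (hme θ) (fun y => ‖F y‖)
    rw [this]
    exact integrable_const _
  have hswap := integral_integral_swap (f := fun θ y => G (θ, y)) hGint
  have hL : ∫ θ, ∫ y, G (θ, y) ∂planeMeasure ∂ν
      = ((2 * Real.pi : ℝ) : ℂ) * ∫ y, F y ∂planeMeasure := by
    have : (fun θ : ℝ => ∫ y, G (θ, y) ∂planeMeasure) = fun _ => ∫ y, F y ∂planeMeasure := by
      ext θ
      exact (hmp θ).integral_comp (hme θ) F
    rw [this, integral_const, hν]
    simp [Real.two_pi_pos.le]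
  have hR : ∀ y, ∫ θ, G (θ, y) ∂ν
      = ((2 * Real.pi : ℝ) : ℂ) * (h 0 * (Real.exp (-N * ‖y‖ ^ 2) : ℂ)) := by
    intro y
    have hca : Real.circleAverage (fun ζ => h (ζ * y)) 0 1 = h 0 := by
      have := DiffContOnCl.circleAverage (c := 0) (R := 1) (f := fun ζ => h (ζ * y))
        (Differentiable.diffContOnCl (by fun_prop))
      simpa using this
    rw [Real.circleAverage_def, inv_smul_eq_iff₀ Real.two_pi_pos.ne'] at hca
    have : ∀ θ : ℝ, G (θ, y) = h (circleMap 0 1 θ * y) * (Real.exp (-N * ‖y‖ ^ 2) : ℂ) := by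
      intro θ
      simp only [hG, hF, norm_mul, norm_circleMap_zero, abs_one, one_mul]
      ring
    simp_rw [this]
    rw [integral_mul_const, hν, ← intervalIntegral.integral_of_le Real.two_pi_pos.le, hca,
      Complex.real_smul]
    ring
  rw [hL] at hswap
  simp_rw [hR] at hswap
  rw [integral_const_mul, integral_const_mul, integral_complex_ofReal,
    integral_gaussian_planeMeasure hN] at hswap
  have h2 := mul_left_cancel₀ (by exact_mod_cast Real.two_pi_pos.ne') hswap
  rw [integral_const_mul, h2]
  have : (N : ℂ) ≠ 0 := by exact_mod_cast hN.ne'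
  push_cast
  field_simp

/-- The reproducing property of the coherent states. -/
lemma inner_coherent_of_entire (hN : 0 < N) (x : ℂ) {u : PlaneL2} {g : ℂ → ℂ}
    (hg : Differentiable ℂ g)
    (hu : u =ᵐ[planeMeasure] fun z => g z * (Real.exp (-N * ‖z‖ ^ 2 / 2) : ℂ)) :
    ⟪coherent hN x, u⟫_ℂ = g x * (Real.exp (-N * ‖x‖ ^ 2 / 2) : ℂ) := by
  have hN0 : (N : ℂ) ≠ 0 := by exact_mod_cast hN.ne'
  set h : ℂ → ℂ := fun y => Complex.exp (-N * (starRingEnd ℂ x) * y) * g (x + y) with hh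
  -- After the translation `z = x + y` the integrand is a Gaussian in `y` times an entire function.
  have hpt : ∀ y, ginibreKernel N x (x + y) * (g (x + y) *
      (Real.exp (-N * ‖x + y‖ ^ 2 / 2) : ℂ))
      = (Real.exp (-N * ‖x‖ ^ 2 / 2) : ℂ) *
        ((N : ℂ) * ((Real.exp (-N * ‖y‖ ^ 2) : ℂ) * h y)) := by
    intro y
    have e : Complex.exp (N * (x * (starRingEnd ℂ) (x + y) - (‖x‖ : ℂ) ^ 2 / 2
          - (‖x + y‖ : ℂ) ^ 2 / 2)) * Complex.exp ((-N * ‖x + y‖ ^ 2 / 2 : ℝ) : ℂ)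
        = Complex.exp ((-N * ‖x‖ ^ 2 / 2 : ℝ) : ℂ) * (Complex.exp ((-N * ‖y‖ ^ 2 : ℝ) : ℂ) *
          Complex.exp (-N * (starRingEnd ℂ x) * y)) := by
      rw [← Complex.exp_add, ← Complex.exp_add, ← Complex.exp_add]
      congr 1
      push_cast
      rw [← Complex.mul_conj' (x + y), ← Complex.mul_conj' x, ← Complex.mul_conj' y, map_add]
      ring
    simp only [ginibreKernel, hh, Complex.ofReal_exp]
    linear_combination (N : ℂ) * g (x + y) * e
  have hint0 : Integrable (fun z => ginibreKernel N x z * u z) planeMeasure := by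
    have := L2.integrable_inner (𝕜 := ℂ) (coherent hN x) u
    refine this.congr ?_
    filter_upwards [coeFn_coherent hN x] with z hz
    rw [hz, RCLike.inner_apply, conj_ginibreKernel, mul_comm]
  have hint : Integrable (fun z => ginibreKernel N x z *
      (g z * (Real.exp (-N * ‖z‖ ^ 2 / 2) : ℂ))) planeMeasure := by
    refine hint0.congr ?_
    filter_upwards [hu] with z hz
    rw [hz]
  have hint2 := hint.comp_add_left x
  simp_rw [hpt] at hint2
  have hE : (Real.exp (-N * ‖x‖ ^ 2 / 2) : ℂ) ≠ 0 := by exact_mod_cast (Real.exp_pos _).ne'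
  have hint3 : Integrable (fun y => (Real.exp (-N * ‖y‖ ^ 2) : ℂ) * h y) planeMeasure := by
    have := (hint2.const_mul (Real.exp (-N * ‖x‖ ^ 2 / 2) : ℂ)⁻¹).const_mul (N : ℂ)⁻¹
    refine this.congr (ae_of_all _ fun y => ?_)
    simp only
    field_simp
  have hhd : Differentiable ℂ h := by
    have := hg.comp (differentiable_id.const_add x)
    simp only [hh]
    exact (by fun_prop : Differentiable ℂ fun y =>
      Complex.exp (-N * (starRingEnd ℂ x) * y)).mul this
  calc ⟪coherent hN x, u⟫_ℂ
      = ∫ z, ginibreKernel N x z * (g z * (Real.exp (-N * ‖z‖ ^ 2 / 2) : ℂ)) ∂planeMeasure := by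
        rw [inner_coherent]
        apply integral_congr_ae
        filter_upwards [hu] with z hz
        rw [hz]
    _ = ∫ y, ginibreKernel N x (x + y) * (g (x + y) *
          (Real.exp (-N * ‖x + y‖ ^ 2 / 2) : ℂ)) ∂planeMeasure :=
        (integral_add_left_eq_self _ x).symm
    _ = g x * (Real.exp (-N * ‖x‖ ^ 2 / 2) : ℂ) := by
        simp_rw [hpt]
        rw [integral_const_mul, integral_gaussian_mul_entire hN hhd hint3]
        simp [hh, mul_comm]

lemma coeFn_eq_inner_coherent (hN : 0 < N) {u : PlaneL2} (hu : u ∈ fock N) :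
    u =ᵐ[planeMeasure] fun x => ⟪coherent hN x, u⟫_ℂ := by
  obtain ⟨g, hg, hug⟩ := hu
  filter_upwards [hug] with x hx
  rw [hx, inner_coherent_of_entire hN x hg hug]

lemma coeFn_starProjection_fock (hN : 0 < N) (u : PlaneL2) :
    (fock N).starProjection u =ᵐ[planeMeasure] fun x => ⟪coherent hN x, u⟫_ℂ := by
  filter_upwards [coeFn_eq_inner_coherent hN ((fock N).starProjection_apply_mem u)] with x hx
  rw [hx, ← Submodule.inner_starProjection_left_eq_right,
    Submodule.starProjection_eq_self_iff.2 (coherent_mem_fock hN x)]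

lemma inner_coherent_coherent (hN : 0 < N) (x z : ℂ) :
    ⟪coherent hN x, coherent hN z⟫_ℂ = ginibreKernel N x z := by
  have hd : Differentiable ℂ fun y : ℂ =>
      N * Complex.exp (N * (y * (starRingEnd ℂ) z - (‖z‖ : ℂ) ^ 2 / 2)) := by fun_prop
  have e : ∀ y : ℂ, ginibreKernel N y z =
      N * Complex.exp (N * (y * (starRingEnd ℂ) z - (‖z‖ : ℂ) ^ 2 / 2)) *
        (Real.exp (-N * ‖y‖ ^ 2 / 2) : ℂ) := by
    intro y
    rw [ginibreKernel, mul_assoc, Complex.ofReal_exp, ← Complex.exp_add]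
    congr 2
    push_cast
    ring
  rw [e]
  refine inner_coherent_of_entire hN x hd ?_
  filter_upwards [coeFn_coherent hN z] with y hy
  rw [hy, e]

lemma norm_coherent (hN : 0 < N) (x : ℂ) : ‖coherent hN x‖ = √N := by
  have h := inner_self_eq_norm_sq_to_K (𝕜 := ℂ) (coherent hN x)
  rw [inner_coherent_coherent, ginibreKernel, Complex.mul_conj'] at h
  have h2 : (N : ℂ) = ((‖coherent hN x‖ ^ 2 : ℝ) : ℂ) := by
    rw [Complex.ofReal_pow]
    refine Eq.trans ?_ h
    ring_nf
    simp
  have h3 : N = ‖coherent hN x‖ ^ 2 := by exact_mod_cast h2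
  exact (Real.sqrt_eq_iff_eq_sq hN.le (norm_nonneg _)).2 h3 |>.symm

lemma continuous_coherent (hN : 0 < N) : Continuous (coherent hN) := by
  rw [continuous_iff_continuousAt]
  intro x
  rw [ContinuousAt, tendsto_iff_norm_sub_tendsto_zero]
  have h : ∀ y, ‖coherent hN y - coherent hN x‖ ^ 2
      = 2 * N - 2 * (ginibreKernel N y x).re := by
    intro y
    rw [norm_sub_sq (𝕜 := ℂ), norm_coherent, norm_coherent, Real.sq_sqrt hN.le,
      inner_coherent_coherent]
    simp only [RCLike.re_to_complex]
    ring
  have hx : 2 * N - 2 * (ginibreKernel N x x).re = 0 := by rw [← h]; simp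
  have h1 : Tendsto (fun y => ‖coherent hN y - coherent hN x‖ ^ 2) (𝓝 x) (𝓝 0) := by
    simp_rw [h]
    rw [← hx]
    have := continuous_ginibreKernel_left (N := N) x
    exact Continuous.tendsto (by fun_prop) x
  have h2 := h1.sqrt
  simpa [Real.sqrt_sq (norm_nonneg _)] using h2

end

/-! ### Multiplication operators and the Schur test -/

section

/-- Multiplication by an essentially bounded real function, as a bounded operator on `L²(ℂ, γ)`. -/
def boundedMul {φ : ℂ → ℝ} (hφ : MemLp (fun z => (φ z : ℂ)) ∞ planeMeasure) :
    PlaneL2 →L[ℂ] PlaneL2 :=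
  (ContinuousLinearMap.mul ℂ ℂ).holderL planeMeasure ∞ 2 2 hφ.toLp

lemma coeFn_boundedMul {φ : ℂ → ℝ} (hφ : MemLp (fun z => (φ z : ℂ)) ∞ planeMeasure)
    (u : PlaneL2) : boundedMul hφ u =ᵐ[planeMeasure] fun z => (φ z : ℂ) * u z := by
  have h := (ContinuousLinearMap.mul ℂ ℂ).coeFn_holder (r := 2) hφ.toLp u
  filter_upwards [h, hφ.coeFn_toLp] with z h1 h2
  rw [boundedMul, ContinuousLinearMap.holderL_apply_apply, h1, h2]
  rfl

lemma memLp_top_ofReal {φ : ℂ → ℝ} (hc : Continuous φ) {C : ℝ} (hb : ∀ z, |φ z| ≤ C) :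
    MemLp (fun z => (φ z : ℂ)) ∞ planeMeasure :=
  memLp_top_of_bound (Complex.continuous_ofReal.comp hc).aestronglyMeasurable C
    (ae_of_all _ fun z => by simpa using hb z)

lemma norm_sq_eq_integral (u : PlaneL2) : ‖u‖ ^ 2 = ∫ z, ‖u z‖ ^ 2 ∂planeMeasure := by
  have h := inner_self_eq_norm_sq_to_K (𝕜 := ℂ) u
  rw [L2.inner_def] at h
  have h2 : (∫ z, ⟪u z, u z⟫_ℂ ∂planeMeasure) = ((∫ z, ‖u z‖ ^ 2 ∂planeMeasure : ℝ) : ℂ) := by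
    rw [← integral_complex_ofReal]
    congr 1
    ext z
    rw [inner_self_eq_norm_sq_to_K]
    simp
  rw [h2] at h
  have h3 : ((∫ z, ‖u z‖ ^ 2 ∂planeMeasure : ℝ) : ℂ) = ((‖u‖ ^ 2 : ℝ) : ℂ) := by
    rw [h, Complex.ofReal_pow]
    rfl
  exact (Complex.ofReal_injective h3).symm

lemma integrable_norm_sq (u : PlaneL2) : Integrable (fun z => ‖u z‖ ^ 2) planeMeasure :=
  (memLp_two_iff_integrable_sq_norm (Lp.memLp u).1).1 (Lp.memLp u)

lemma eLpNorm_two_sq (f : ℂ → ℂ) :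
    eLpNorm f 2 planeMeasure ^ 2 = ∫⁻ x, ‖f x‖ₑ ^ 2 ∂planeMeasure := by
  have := eLpNorm_nnreal_pow_eq_lintegral (f := f) (μ := planeMeasure) (p := 2) two_ne_zero
  simpa using this

/-- The Gaussian `M N exp(-N |y|² / 4)`, of total mass `4 M`, which dominates all the integral
kernels below. -/
def gaussianKernel (N M : ℝ) (y : ℂ) : ℝ := M * (N * Real.exp (-(N / 4) * ‖y‖ ^ 2))

lemma measurable_gaussianKernel (N M : ℝ) : Measurable (gaussianKernel N M) := by
  unfold gaussianKernel
  fun_prop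

variable {N M : ℝ}

lemma lintegral_gaussianKernel (hN : 0 < N) (hM : 0 ≤ M) :
    ∫⁻ y, ENNReal.ofReal (gaussianKernel N M y) ∂planeMeasure = ENNReal.ofReal (4 * M) := by
  simp_rw [gaussianKernel, ← mul_assoc, ENNReal.ofReal_mul (mul_nonneg hM hN.le)]
  rw [lintegral_const_mul _ (by fun_prop), lintegral_gaussian_planeMeasure (by positivity),
    ← ENNReal.ofReal_mul (mul_nonneg hM hN.le)]
  congr 1
  field_simp

lemma lintegral_mul_sq_le (κ h : ℂ → ℝ≥0∞) (hκ : AEMeasurable κ planeMeasure)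
    (hh : AEMeasurable h planeMeasure) :
    (∫⁻ z, κ z * h z ∂planeMeasure) ^ 2
      ≤ (∫⁻ z, κ z ∂planeMeasure) * ∫⁻ z, κ z * h z ^ 2 ∂planeMeasure := by
  have hs : ∀ a : ℝ≥0∞, (a ^ (1 / 2 : ℝ)) ^ 2 = a := fun a => by
    rw [← ENNReal.rpow_natCast, ← ENNReal.rpow_mul]; norm_num
  have := ENNReal.lintegral_mul_le_Lp_mul_Lq planeMeasure (p := 2) (q := 2)
    Real.HolderConjugate.two_two (f := fun z => κ z ^ (1 / 2 : ℝ))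
    (g := fun z => κ z ^ (1 / 2 : ℝ) * h z) (hκ.pow_const _) ((hκ.pow_const _).mul hh)
  simp only [Pi.mul_apply, ENNReal.rpow_ofNat, mul_pow, hs, ← mul_assoc, ← sq] at this
  calc _ ≤ _ := pow_le_pow_left' this 2
    _ = _ := by rw [mul_pow, hs, hs]

/-- Schur test for an operator whose kernel, conjugated by the weight `exp Φ`, is dominated by a
Gaussian. -/
lemma eLpNorm_weighted_le (hN : 0 < N) (hM : 0 ≤ M) {Φ : ℂ → ℝ} (hΦ : Measurable Φ)
    {h G : ℂ → ℂ} (hh : AEStronglyMeasurable h planeMeasure)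
    (hG : ∀ᵐ x ∂planeMeasure, ∃ q : ℂ → ℂ, G x = ∫ z, q z * h z ∂planeMeasure ∧
      ∀ z, Real.exp (Φ x - Φ z) * ‖q z‖ ≤ gaussianKernel N M (x - z)) :
    eLpNorm (fun x => (Real.exp (Φ x) : ℂ) * G x) 2 planeMeasure
      ≤ ENNReal.ofReal (4 * M) * eLpNorm (fun x => (Real.exp (Φ x) : ℂ) * h x) 2 planeMeasure := by
  set W : ℂ → ℂ := fun x => (Real.exp (Φ x) : ℂ) * h x with hW
  have hWm : AEStronglyMeasurable W planeMeasure :=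
    (Complex.measurable_ofReal.comp (Real.measurable_exp.comp hΦ)).aestronglyMeasurable.mul hh
  set κ : ℂ → ℂ → ℝ≥0∞ := fun x z => ENNReal.ofReal (gaussianKernel N M (x - z)) with hκ
  have hκm : Measurable fun p : ℂ × ℂ => κ p.1 p.2 :=
    ENNReal.measurable_ofReal.comp
      ((measurable_gaussianKernel N M).comp (measurable_fst.sub measurable_snd))
  have hκ1 : ∀ x, ∫⁻ z, κ x z ∂planeMeasure = ENNReal.ofReal (4 * M) := by
    intro x
    have : ∀ z, κ x z = ENNReal.ofReal (gaussianKernel N M (z - x)) := by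
      intro z
      simp only [hκ, gaussianKernel, norm_sub_rev]
    simp_rw [this]
    rw [lintegral_sub_right_eq_self (fun y => ENNReal.ofReal (gaussianKernel N M y)) x,
      lintegral_gaussianKernel hN hM]
  have hκ2 : ∀ z, ∫⁻ x, κ x z ∂planeMeasure = ENNReal.ofReal (4 * M) := by
    intro z
    rw [lintegral_sub_right_eq_self (fun y => ENNReal.ofReal (gaussianKernel N M y)) z,
      lintegral_gaussianKernel hN hM]
  have hpt : ∀ᵐ x ∂planeMeasure, ‖(Real.exp (Φ x) : ℂ) * G x‖ₑ ^ 2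
      ≤ ENNReal.ofReal (4 * M) * ∫⁻ z, κ x z * ‖W z‖ₑ ^ 2 ∂planeMeasure := by
    filter_upwards [hG] with x ⟨q, hq, hqb⟩
    rw [← hκ1 x]
    refine le_trans (pow_le_pow_left' ?_ 2) (lintegral_mul_sq_le (κ x) (fun z => ‖W z‖ₑ)
      (hκm.comp measurable_prodMk_left).aemeasurable hWm.enorm)
    rw [hq, ← integral_const_mul]
    refine (enorm_integral_le_lintegral_enorm _).trans (lintegral_mono fun z => ?_)
    simp only [hκ, hW]
    rw [← ofReal_norm, ← ofReal_norm, ← ENNReal.ofReal_mul' (norm_nonneg _)]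
    apply ENNReal.ofReal_le_ofReal
    simp only [norm_mul, Complex.norm_real, Real.norm_eq_abs, Real.abs_exp]
    calc Real.exp (Φ x) * (‖q z‖ * ‖h z‖)
        = (Real.exp (Φ x - Φ z) * ‖q z‖) * (Real.exp (Φ z) * ‖h z‖) := by
          rw [Real.exp_sub]
          have := (Real.exp_pos (Φ z)).ne'
          field_simp
      _ ≤ _ := by gcongr; exact hqb z
  have hW2 : AEMeasurable (fun z => ‖W z‖ₑ ^ 2) planeMeasure := hWm.enorm.pow_const 2
  have hm2 : AEMeasurable (Function.uncurry fun x z => κ x z * ‖W z‖ₑ ^ 2)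
      (planeMeasure.prod planeMeasure) :=
    hκm.aemeasurable.mul
      (hW2.comp_quasiMeasurePreserving Measure.quasiMeasurePreserving_snd)
  rw [← ENNReal.pow_le_pow_left_iff two_ne_zero, mul_pow, eLpNorm_two_sq, eLpNorm_two_sq]
  calc _ ≤ ∫⁻ x, ENNReal.ofReal (4 * M) * ∫⁻ z, κ x z * ‖W z‖ₑ ^ 2 ∂planeMeasure ∂planeMeasure :=
        lintegral_mono_ae hpt
    _ = ENNReal.ofReal (4 * M) *
        ∫⁻ x, ∫⁻ z, κ x z * ‖W z‖ₑ ^ 2 ∂planeMeasure ∂planeMeasure :=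
        lintegral_const_mul' _ _ ENNReal.ofReal_ne_top
    _ = ENNReal.ofReal (4 * M) *
        ∫⁻ z, ∫⁻ x, κ x z * ‖W z‖ₑ ^ 2 ∂planeMeasure ∂planeMeasure := by
        rw [lintegral_lintegral_swap hm2]
    _ = ENNReal.ofReal (4 * M) * (ENNReal.ofReal (4 * M) * ∫⁻ z, ‖W z‖ₑ ^ 2 ∂planeMeasure) := by
        congr 1
        rw [← lintegral_const_mul' _ _ ENNReal.ofReal_ne_top]
        congr 1
        ext z
        have hm : Measurable fun x => κ x z := ENNReal.measurable_ofReal.comp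
          ((measurable_gaussianKernel N M).comp (measurable_id.sub_const z))
        rw [lintegral_mul_const _ hm, hκ2]
    _ = _ := by rw [sq (ENNReal.ofReal (4 * M)), mul_assoc]

/-! ### Slowly varying potentials -/

variable {V : ℂ → ℝ} {K : NNReal}

lemma le_mul_exp_of_lipschitz_log (hV : ∀ z, 0 < V z)
    (hLip : LipschitzWith K fun z => Real.log (V z)) (x z : ℂ) :
    V x ≤ V z * Real.exp (K * ‖x - z‖) := by
  have h := hLip.dist_le_mul x z
  rw [Real.dist_eq, dist_eq_norm] at h
  rw [← Real.log_le_log_iff (hV x) (mul_pos (hV z) (Real.exp_pos _)),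
    Real.log_mul (hV z).ne' (Real.exp_pos _).ne', Real.log_exp]
  linarith [le_abs_self (Real.log (V x) - Real.log (V z))]

lemma abs_sub_le_of_lipschitz_log (hV : ∀ z, 0 < V z)
    (hLip : LipschitzWith K fun z => Real.log (V z)) (x z : ℂ) :
    |V x - V z| ≤ V x * (K * ‖x - z‖ * Real.exp (K * ‖x - z‖)) := by
  have h1 := le_mul_exp_of_lipschitz_log hV hLip x z
  have h2 := le_mul_exp_of_lipschitz_log hV hLip z x
  rw [norm_sub_rev] at h2
  set s : ℝ := K * ‖x - z‖ with hs
  have hs0 : 0 ≤ s := by positivity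
  have h3 : 1 - s ≤ Real.exp (-s) := by linarith [Real.add_one_le_exp (-s)]
  have h4 : 1 ≤ Real.exp s := Real.one_le_exp hs0
  have h5 : Real.exp s - 1 ≤ s * Real.exp s := by
    have := mul_le_mul_of_nonneg_right h3 (Real.exp_pos s).le
    rw [← Real.exp_add] at this
    simp at this
    linarith
  have hx := hV x
  rw [abs_le]
  constructor
  · nlinarith
  · have h6 : V x * Real.exp (-s) ≤ V z := by
      rw [Real.exp_neg, ← div_eq_mul_inv, div_le_iff₀ (Real.exp_pos s)]
      exact h1
    nlinarith [mul_le_mul_of_nonneg_left h3 hx.le, mul_le_mul_of_nonneg_left h4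
      (mul_nonneg hx.le hs0)]

lemma continuous_of_lipschitz_log (hV : ∀ z, 0 < V z)
    (hLip : LipschitzWith K fun z => Real.log (V z)) : Continuous V := by
  have : V = fun z => Real.exp (Real.log (V z)) := by
    ext z
    rw [Real.exp_log (hV z)]
  rw [this]
  exact Real.continuous_exp.comp hLip.continuous

/-- Completing the square: at scale `N^(-1/2)`, a Gaussian absorbs any exponential factor. -/
lemma exp_mul_gaussian_le (hN : 1 ≤ N) {L : ℝ} (K : NNReal) {d : ℝ} (hd : 0 ≤ d) :
    Real.exp (√N * (L * d)) * ((1 + √N * d) * Real.exp (K * d)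
        * (N * Real.exp (-(N / 2) * d ^ 2)))
      ≤ Real.exp ((K + L + 1) ^ 2) * (N * Real.exp (-(N / 4) * d ^ 2)) := by
  have hs : 1 ≤ √N := Real.one_le_sqrt.2 hN
  have hs2 : √N ^ 2 = N := Real.sq_sqrt (by linarith)
  have h1 : 1 + √N * d ≤ Real.exp (√N * d) := by linarith [Real.add_one_le_exp (√N * d)]
  calc _ ≤ Real.exp (√N * (L * d)) * (Real.exp (√N * d) * Real.exp (K * (√N * d))
        * (N * Real.exp (-(N / 2) * d ^ 2))) := by
        gcongr
        nlinarith
    _ = N * Real.exp (√N * (L * d) + (√N * d + K * (√N * d)) + -(N / 2) * d ^ 2) := by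
        rw [Real.exp_add, Real.exp_add, Real.exp_add]
        ring
    _ ≤ N * Real.exp ((K + L + 1) ^ 2 + -(N / 4) * d ^ 2) := by
        refine mul_le_mul_of_nonneg_left (Real.exp_le_exp.2 ?_) (by linarith)
        have : N * d ^ 2 = (√N * d) ^ 2 := by rw [mul_pow, hs2]
        have h2 := sq_nonneg ((K + L + 1) - √N * d / 2)
        linear_combination h2 - this / 4
    _ = _ := by rw [Real.exp_add]; ring

lemma weighted_kernel_le (hN : 1 ≤ N) {L : ℝ} (K : NNReal) {ψ : ℂ → ℝ}
    (hψ : ∀ x z, ψ x - ψ z ≤ L * ‖x - z‖) (x z : ℂ) {q : ℝ}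
    (hq : |q| ≤ Real.exp (K * ‖x - z‖)) :
    Real.exp (√N * ψ x - √N * ψ z) * ‖(q : ℂ) * ginibreKernel N x z‖
      ≤ gaussianKernel N (Real.exp ((K + L + 1) ^ 2)) (x - z) := by
  refine le_trans ?_ (exp_mul_gaussian_le hN (L := L) K (norm_nonneg (x - z)))
  rw [norm_mul, norm_ginibreKernel (by linarith), Complex.norm_real, Real.norm_eq_abs, ← mul_sub]
  have h1 : |q| ≤ (1 + √N * ‖x - z‖) * Real.exp (K * ‖x - z‖) := by
    nlinarith [Real.exp_pos (K * ‖x - z‖), mul_nonneg (mul_nonneg (Real.sqrt_nonneg N)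
      (norm_nonneg (x - z))) (Real.exp_pos (K * ‖x - z‖)).le]
  have := hψ x z
  gcongr

lemma weighted_kernel_le_of_small (hN : 1 ≤ N) {L : ℝ} (K : NNReal) {ψ : ℂ → ℝ}
    (hψ : ∀ x z, ψ x - ψ z ≤ L * ‖x - z‖) (x z : ℂ) {q : ℝ}
    (hq : |q| ≤ K * ‖x - z‖ * Real.exp (K * ‖x - z‖)) :
    Real.exp (√N * ψ x - √N * ψ z) * ‖(q : ℂ) * ginibreKernel N x z‖
      ≤ gaussianKernel N (K * Real.exp ((K + L + 1) ^ 2) / √N) (x - z) := by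
  have hs : 0 < √N := Real.sqrt_pos.2 (by linarith)
  have h0 := mul_le_mul_of_nonneg_left (exp_mul_gaussian_le hN (L := L) K (norm_nonneg (x - z)))
    (div_nonneg K.coe_nonneg hs.le)
  have e : gaussianKernel N (K * Real.exp ((K + L + 1) ^ 2) / √N) (x - z)
      = (K : ℝ) / √N * (Real.exp ((K + L + 1) ^ 2) * (N * Real.exp (-(N / 4) * ‖x - z‖ ^ 2))) := by
    rw [gaussianKernel]; ring
  rw [e]
  refine le_trans ?_ h0
  rw [norm_mul, norm_ginibreKernel (by linarith), Complex.norm_real, Real.norm_eq_abs, ← mul_sub]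
  have h1 : |q| ≤ K / √N * ((1 + √N * ‖x - z‖) * Real.exp (K * ‖x - z‖)) := by
    refine hq.trans ?_
    rw [← mul_assoc]
    refine mul_le_mul_of_nonneg_right ?_ (Real.exp_pos _).le
    rw [div_mul_eq_mul_div, le_div_iff₀ hs]
    nlinarith [K.coe_nonneg, norm_nonneg (x - z)]
  have h2 := hψ x z
  calc _ ≤ Real.exp (√N * (L * ‖x - z‖)) *
        (K / √N * ((1 + √N * ‖x - z‖) * Real.exp (K * ‖x - z‖)) *
          (N * Real.exp (-(N / 2) * ‖x - z‖ ^ 2))) := by gcongr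
    _ = _ := by ring

end

/-! ### The resolvent of the Toeplitz operator -/

section

variable {N : ℝ} {V : ℂ → ℝ} {K : NNReal}

lemma norm_le_of_eLpNorm_le {u v : PlaneL2} {f g : ℂ → ℂ} {c : ℝ} (hc : 0 ≤ c)
    (hu : u =ᵐ[planeMeasure] f) (hv : v =ᵐ[planeMeasure] g)
    (h : eLpNorm f 2 planeMeasure ≤ ENNReal.ofReal c * eLpNorm g 2 planeMeasure) :
    ‖u‖ ≤ c * ‖v‖ := by
  rw [← eLpNorm_congr_ae hu, ← eLpNorm_congr_ae hv] at h
  have h2 := ENNReal.toReal_mono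
    (ENNReal.mul_ne_top ENNReal.ofReal_ne_top (Lp.eLpNorm_ne_top v)) h
  rwa [ENNReal.toReal_mul, ENNReal.toReal_ofReal hc, ← Lp.norm_def, ← Lp.norm_def] at h2

lemma integrable_ginibreKernel_mul (hN : 0 < N) (x : ℂ) (u : PlaneL2) :
    Integrable (fun z => ginibreKernel N x z * u z) planeMeasure := by
  refine (L2.integrable_inner (𝕜 := ℂ) (coherent hN x) u).congr ?_
  filter_upwards [coeFn_coherent hN x] with z hz
  rw [hz, RCLike.inner_apply, conj_ginibreKernel, mul_comm]

lemma coeFn_starProjection_fock_of_ae (hN : 0 < N) {u : PlaneL2} {f : ℂ → ℂ}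
    (hu : u =ᵐ[planeMeasure] f) : (fock N).starProjection u =ᵐ[planeMeasure]
      fun x => ∫ z, ginibreKernel N x z * f z ∂planeMeasure := by
  filter_upwards [coeFn_starProjection_fock hN u] with x hx
  rw [hx, inner_coherent]
  apply integral_congr_ae
  filter_upwards [hu] with z hz
  rw [hz]

lemma memLp_of_mem_domain (y : (toeplitz N V).domain) :
    MemLp (fun z => (V z : ℂ) * ((y : fock N) : PlaneL2) z) 2 planeMeasure := y.2

lemma coe_toeplitz_apply (y : (toeplitz N V).domain) :
    ((toeplitz N V y : fock N) : PlaneL2)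
      = (fock N).starProjection (memLp_of_mem_domain y).toLp :=
  rfl

lemma inner_toeplitz (x : fock N) (y : (toeplitz N V).domain) :
    ⟪x, toeplitz N V y⟫_ℂ
      = ∫ z, (V z : ℂ) * ⟪(x : PlaneL2) z, ((y : fock N) : PlaneL2) z⟫_ℂ ∂planeMeasure := by
  rw [Submodule.coe_inner, coe_toeplitz_apply, ← Submodule.inner_starProjection_left_eq_right,
    Submodule.starProjection_eq_self_iff.2 x.2, L2.inner_def]
  apply integral_congr_ae
  filter_upwards [(memLp_of_mem_domain y).coeFn_toLp] with z hz
  rw [hz, RCLike.inner_apply, RCLike.inner_apply, mul_assoc]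

lemma toeplitz_isFormalAdjoint : (toeplitz N V).IsFormalAdjoint (toeplitz N V) := by
  intro x y
  rw [← inner_conj_symm, inner_toeplitz, inner_toeplitz, ← integral_conj]
  congr 1
  ext z
  rw [map_mul, Complex.conj_ofReal, inner_conj_symm]

lemma re_inner_toeplitz_nonneg (hV : ∀ z, 0 < V z) (y : (toeplitz N V).domain) :
    0 ≤ (⟪(y : fock N), toeplitz N V y⟫_ℂ).re := by
  have h : ⟪(y : fock N), toeplitz N V y⟫_ℂ
      = ((∫ z, V z * ‖((y : fock N) : PlaneL2) z‖ ^ 2 ∂planeMeasure : ℝ) : ℂ) := by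
    rw [inner_toeplitz, ← integral_complex_ofReal]
    congr 1
    ext z
    rw [inner_self_eq_norm_sq_to_K]
    simp
  rw [h, Complex.ofReal_re]
  exact integral_nonneg fun z => mul_nonneg (hV z).le (by positivity)

lemma norm_le_norm_toeplitz_add (hV : ∀ z, 0 < V z) (y : (toeplitz N V).domain) :
    ‖(y : fock N)‖ ≤ ‖toeplitz N V y + (y : fock N)‖ := by
  have h1 := re_inner_toeplitz_nonneg hV y
  have h2 := re_inner_le_norm (𝕜 := ℂ) (y : fock N) (toeplitz N V y + (y : fock N))
  rw [inner_add_right, inner_self_eq_norm_sq_to_K] at h2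
  have h3 : RCLike.re (⟪(y : fock N), toeplitz N V y⟫_ℂ + ((‖(y : fock N)‖ : ℝ) : ℂ) ^ 2)
      = (⟪(y : fock N), toeplitz N V y⟫_ℂ).re + ‖(y : fock N)‖ ^ 2 := by
    simp only [RCLike.re_to_complex, Complex.add_re, ← Complex.ofReal_pow, Complex.ofReal_re]
  have h4 := h3.symm.trans_le h2
  rcases (norm_nonneg (y : fock N)).eq_or_lt with h0 | h0
  · rw [← h0]; positivity
  · nlinarith

/-- The relative size of the commutator `[V, P_N]`, conjugated by `exp (√N ψ)` with `ψ` an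
`L`-Lipschitz function. -/
def commutatorBound (N L : ℝ) (K : NNReal) : ℝ := 4 * (K * Real.exp ((K + L + 1) ^ 2) / √N)

lemma commutatorBound_nonneg (N L : ℝ) (K : NNReal) : 0 ≤ commutatorBound N L K := by
  unfold commutatorBound
  positivity

lemma tendsto_commutatorBound (L : ℝ) (K : NNReal) :
    Tendsto (fun N => commutatorBound N L K) atTop (𝓝 0) := by
  have := (Tendsto.const_div_atTop Real.tendsto_sqrt_atTop
    (K * Real.exp ((K + L + 1) ^ 2))).const_mul 4
  simpa [commutatorBound] using this

lemma memLp_resolventSymbol (hV : ∀ z, 0 < V z) (hVc : Continuous V) :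
    MemLp (fun z => (((1 + V z)⁻¹ : ℝ) : ℂ)) ∞ planeMeasure := by
  refine memLp_top_ofReal (hVc.const_add 1 |>.inv₀ fun z => by linarith [hV z]) (C := 1) fun z => ?_
  have := hV z
  rw [abs_of_pos (by positivity)]
  exact inv_le_one_of_one_le₀ (by linarith)

/-- The parametrix `P_N (1 + V)⁻¹` of `(H_N + 1)⁻¹`. -/
def parametrix (N : ℝ) (hV : ∀ z, 0 < V z) (hVc : Continuous V) : fock N →L[ℂ] fock N :=
  (fock N).orthogonalProjectionOnto ∘L boundedMul (memLp_resolventSymbol hV hVc) ∘L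
    (fock N).subtypeL

lemma coeFn_parametrix (hN : 0 < N) (hV : ∀ z, 0 < V z) (hVc : Continuous V) (g : fock N) :
    (parametrix N hV hVc g : PlaneL2) =ᵐ[planeMeasure] fun x => ∫ z, ginibreKernel N x z *
      ((((1 + V z)⁻¹ : ℝ) : ℂ) * (g : PlaneL2) z) ∂planeMeasure :=
  coeFn_starProjection_fock_of_ae hN (coeFn_boundedMul (memLp_resolventSymbol hV hVc) (g : PlaneL2))

lemma coeFn_fock (hN : 0 < N) (g : fock N) : (g : PlaneL2) =ᵐ[planeMeasure]
    fun x => ∫ z, ginibreKernel N x z * (g : PlaneL2) z ∂planeMeasure := by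
  filter_upwards [coeFn_eq_inner_coherent hN g.2] with x hx
  rw [hx, inner_coherent]

lemma parametrix_mem_domain (hN : 1 ≤ N) (hV : ∀ z, 0 < V z)
    (hLip : LipschitzWith K fun z => Real.log (V z)) (hVc : Continuous V) (g : fock N) :
    parametrix N hV hVc g ∈ (toeplitz N V).domain := by
  refine ⟨((Complex.measurable_ofReal.comp hVc.measurable).aestronglyMeasurable.mul
    (Lp.memLp _).1), ?_⟩
  have hb := eLpNorm_weighted_le (N := N) (M := Real.exp ((K + 0 + 1) ^ 2)) (Φ := fun _ => √N * 0)
    (h := (g : PlaneL2)) (G := fun x => (V x : ℂ) * (parametrix N hV hVc g : PlaneL2) x)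
    (by linarith) (Real.exp_pos _).le measurable_const (Lp.memLp _).1 ?_
  · simp only [mul_zero, Real.exp_zero, Complex.ofReal_one, one_mul] at hb
    exact hb.trans_lt (ENNReal.mul_lt_top ENNReal.ofReal_lt_top (Lp.memLp _).2)
  · filter_upwards [coeFn_parametrix (by linarith) hV hVc g] with x hx
    refine ⟨fun z => ((V x * (1 + V z)⁻¹ : ℝ) : ℂ) * ginibreKernel N x z, ?_, fun z => ?_⟩
    · rw [hx, ← integral_const_mul]
      congr 1
      ext z
      push_cast
      ring
    · refine weighted_kernel_le hN K (ψ := fun _ => 0) (fun x z => by simp) x z ?_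
      have h1 := le_mul_exp_of_lipschitz_log hV hLip x z
      have hx := hV x
      have hz := hV z
      rw [abs_of_pos (by positivity), ← div_eq_mul_inv, div_le_iff₀ (by positivity)]
      nlinarith [Real.exp_pos (K * ‖x - z‖)]

/-- `(H_N + 1) P_N (1 + V)⁻¹` as a map with values in `𝓑_N`. -/
def parametrixImage (hN : 1 ≤ N) (hV : ∀ z, 0 < V z)
    (hLip : LipschitzWith K fun z => Real.log (V z)) (hVc : Continuous V) : fock N →ₗ[ℂ] fock N :=
  (toeplitz N V).toFun ∘ₗ
    (parametrix N hV hVc).toLinearMap.codRestrict _ (parametrix_mem_domain hN hV hLip hVc)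
  + (parametrix N hV hVc).toLinearMap

/-- The error of the parametrix is a commutator of `V` with `P_N`, hence small. -/
lemma norm_parametrixImage_sub_le (hN : 1 ≤ N) (hV : ∀ z, 0 < V z)
    (hLip : LipschitzWith K fun z => Real.log (V z)) (hVc : Continuous V) (g : fock N) :
    ‖parametrixImage hN hV hLip hVc g - g‖ ≤ commutatorBound N 0 K * ‖g‖ := by
  have hN0 : 0 < N := by linarith
  set f := parametrix N hV hVc g with hf
  have hfd : MemLp (fun z => (V z : ℂ) * (f : PlaneL2) z) 2 planeMeasure :=
    parametrix_mem_domain hN hV hLip hVc g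
  set w : PlaneL2 := hfd.toLp + f - g with hw
  have e : ((parametrixImage hN hV hLip hVc g - g : fock N) : PlaneL2)
      = (fock N).starProjection w := by
    rw [hw, map_sub, map_add, Submodule.starProjection_eq_self_iff.2 f.2,
      Submodule.starProjection_eq_self_iff.2 g.2]
    rfl
  change ‖((parametrixImage hN hV hLip hVc g - g : fock N) : PlaneL2)‖ ≤
    commutatorBound N 0 K * ‖(g : PlaneL2)‖
  rw [e]
  refine ((fock N).norm_starProjection_apply_le w).trans ?_
  have hwc : w =ᵐ[planeMeasure]
      fun x => (V x : ℂ) * (f : PlaneL2) x + (f : PlaneL2) x - (g : PlaneL2) x := by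
    filter_upwards [Lp.coeFn_sub (hfd.toLp + (f : PlaneL2)) (g : PlaneL2),
      Lp.coeFn_add hfd.toLp (f : PlaneL2), hfd.coeFn_toLp] with x h1 h2 h3
    rw [hw, h1, Pi.sub_apply, h2, Pi.add_apply, h3]
  have hb := eLpNorm_weighted_le (N := N) (M := K * Real.exp ((K + 0 + 1) ^ 2) / √N)
    (Φ := fun _ => √N * 0) (h := (g : PlaneL2))
    (G := fun x => (V x : ℂ) * (f : PlaneL2) x + (f : PlaneL2) x - (g : PlaneL2) x)
    hN0 (by positivity) measurable_const (Lp.memLp _).1 ?_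
  · simp only [mul_zero, Real.exp_zero, Complex.ofReal_one, one_mul] at hb
    exact norm_le_of_eLpNorm_le (commutatorBound_nonneg N 0 K) hwc (ae_eq_refl _) hb
  · filter_upwards [coeFn_parametrix hN0 hV hVc g, coeFn_fock hN0 g] with x hx hgx
    refine ⟨fun z => (((V x - V z) * (1 + V z)⁻¹ : ℝ) : ℂ) * ginibreKernel N x z, ?_, fun z => ?_⟩
    · have hi : Integrable (fun z => ginibreKernel N x z *
          ((((1 + V z)⁻¹ : ℝ) : ℂ) * (g : PlaneL2) z)) planeMeasure := by
        refine (integrable_ginibreKernel_mul hN0 x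
          (boundedMul (memLp_resolventSymbol hV hVc) (g : PlaneL2))).congr ?_
        filter_upwards [coeFn_boundedMul (memLp_resolventSymbol hV hVc) (g : PlaneL2)] with z hz
        rw [hz]
      rw [hx, ← add_one_mul, ← integral_const_mul, hgx, ← integral_sub (hi.const_mul _)
        (integrable_ginibreKernel_mul hN0 x g)]
      congr 1
      ext z
      have : (1 + V z : ℂ) ≠ 0 := by
        have := hV z
        exact_mod_cast (by positivity : 1 + V z ≠ 0)
      push_cast
      field_simp
      ring
    · refine weighted_kernel_le_of_small hN K (ψ := fun _ => 0) (fun x z => by simp) x z ?_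
      have h1 := abs_sub_le_of_lipschitz_log hV hLip z x
      have hz := hV z
      rw [abs_sub_comm, norm_sub_rev] at h1
      rw [abs_mul, abs_of_pos (by positivity : 0 < (1 + V z)⁻¹), ← div_eq_mul_inv,
        div_le_iff₀ (by positivity)]
      refine h1.trans ?_
      have : 0 ≤ K * ‖x - z‖ * Real.exp (K * ‖x - z‖) := by positivity
      nlinarith

/-- For small commutators `H_N + 1` has a bounded inverse, by a Neumann series. -/
lemma exists_isResolventNegOne (hN : 1 ≤ N) (hV : ∀ z, 0 < V z)
    (hLip : LipschitzWith K fun z => Real.log (V z)) (hsmall : commutatorBound N 0 K < 1) :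
    ∃ R, IsResolventNegOne (toeplitz N V) R := by
  have hVc := continuous_of_lipschitz_log hV hLip
  set T := parametrix N hV hVc
  set S := parametrixImage hN hV hLip hVc with hS
  set E : fock N →L[ℂ] fock N := (LinearMap.id - S).mkContinuous (commutatorBound N 0 K) fun g => by
    rw [LinearMap.sub_apply, norm_sub_rev]
    exact norm_parametrixImage_sub_le hN hV hLip hVc g with hE
  have hE1 : ‖E‖ < 1 :=
    (LinearMap.mkContinuous_norm_le _ (commutatorBound_nonneg N 0 K) _).trans_lt hsmall
  obtain ⟨U, hU⟩ := isUnit_one_sub_of_norm_lt_one (x := E) hE1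
  set J : fock N →L[ℂ] fock N := ((U⁻¹ : (fock N →L[ℂ] fock N)ˣ) : fock N →L[ℂ] fock N) with hJ
  have hSJ : ∀ x, S (J x) = x := by
    intro x
    have h1 : ((U : fock N →L[ℂ] fock N) * J) x = x := by rw [hJ, Units.mul_inv]; rfl
    rw [hU] at h1
    have h2 : ((1 - E) * J) x = J x - E (J x) := rfl
    have h3 : E (J x) = J x - S (J x) := rfl
    rw [h2, h3, sub_sub_cancel] at h1
    exact h1
  refine ⟨T ∘L J, fun x => ⟨parametrix_mem_domain hN hV hLip hVc (J x), hSJ x⟩, fun y => ?_⟩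
  set x := toeplitz N V y + (y : fock N) with hx
  have hd := parametrix_mem_domain hN hV hLip hVc (J x)
  have h1 : toeplitz N V ⟨T (J x), hd⟩ + T (J x) = toeplitz N V y + y := hSJ x
  have h2 := norm_le_norm_toeplitz_add hV (⟨T (J x), hd⟩ - y)
  rw [LinearPMap.map_sub, Submodule.coe_sub] at h2
  have h3 : toeplitz N V ⟨T (J x), hd⟩ - toeplitz N V y + (T (J x) - (y : fock N)) = 0 := by
    rw [← sub_eq_zero] at h1
    rw [← h1]
    abel
  rw [h3, norm_zero] at h2
  exact sub_eq_zero.1 (norm_le_zero_iff.1 h2)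

section Abstract

variable {E : Type*} [NormedAddCommGroup E] [InnerProductSpace ℂ E]

lemma IsResolventNegOne.isSelfAdjoint_resolvent [CompleteSpace E] {A : E →ₗ.[ℂ] E} {R : E →L[ℂ] E}
    (h : IsResolventNegOne A R) (hA : A.IsFormalAdjoint A) : IsSelfAdjoint R := by
  rw [ContinuousLinearMap.isSelfAdjoint_iff_isSymmetric]
  intro x y
  obtain ⟨hx, hx2⟩ := h.1 x
  obtain ⟨hy, hy2⟩ := h.1 y
  have h1 := hA ⟨R x, hx⟩ ⟨R y, hy⟩
  simp only [ContinuousLinearMap.coe_coe]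
  nth_rewrite 1 [← hy2]
  nth_rewrite 2 [← hx2]
  rw [inner_add_left, inner_add_right]
  congr 1
  exact h1.symm

/-- A symmetric operator for which `A + 1` has a bounded inverse is self-adjoint. -/
lemma IsResolventNegOne.isSelfAdjoint [CompleteSpace E] {A : E →ₗ.[ℂ] E} {R : E →L[ℂ] E}
    (h : IsResolventNegOne A R) (hA : A.IsFormalAdjoint A) : IsSelfAdjoint A := by
  have hRs := (ContinuousLinearMap.isSelfAdjoint_iff_isSymmetric.1 (h.isSelfAdjoint_resolvent hA))
  have hdense : Dense (A.domain : Set E) := by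
    rw [Submodule.dense_iff_topologicalClosure_eq_top,
      Submodule.topologicalClosure_eq_top_iff, Submodule.eq_bot_iff]
    intro v hv
    have hRv : R v = 0 := by
      rw [← inner_self_eq_zero (𝕜 := ℂ)]
      obtain ⟨hx, -⟩ := h.1 (R v)
      have h1 := (Submodule.mem_orthogonal _ _).1 hv _ hx
      have h2 := hRs (R v) v
      simp only [ContinuousLinearMap.coe_coe] at h2
      rw [← h2, h1]
    obtain ⟨hx, hx2⟩ := h.1 v
    have : (⟨R v, hx⟩ : A.domain) = 0 := Subtype.ext hRv
    rw [this, LinearPMap.map_zero, hRv, add_zero] at hx2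
    exact hx2.symm
  rw [LinearPMap.isSelfAdjoint_def]
  refine le_antisymm ?_ (hA.le_adjoint hdense)
  have hle := hA.le_adjoint hdense
  -- Every element `y` of the domain of the adjoint is `R ((A† + 1) y)`.
  have key : ∀ y : A.adjoint.domain, R (A.adjoint y + (y : E)) = y := by
    intro y
    refine ext_inner_right ℂ fun v => ?_
    obtain ⟨hv, hv2⟩ := h.1 v
    have h1 := A.adjoint_isFormalAdjoint hdense y ⟨R v, hv⟩
    have h2 := hRs (A.adjoint y + (y : E)) v
    simp only [ContinuousLinearMap.coe_coe] at h2
    rw [h2, inner_add_left, h1, ← inner_add_right, hv2]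
  refine ⟨fun y hy => ?_, fun y x hxy => ?_⟩
  · obtain ⟨hx, -⟩ := h.1 (A.adjoint ⟨y, hy⟩ + y)
    rwa [key ⟨y, hy⟩] at hx
  · have := hle.2 (x := x) (y := y) hxy.symm
    exact this.symm

end Abstract

end

/-! ### Spectral subspaces and a Lyapunov bound -/

section Abstract

variable {E : Type*} [NormedAddCommGroup E] [InnerProductSpace ℂ E]

/-- A Lyapunov bound: if `T` preserves `X`, is accretive there, and the quadratic form `‖W u‖²`
decreases at a definite rate in the direction of `T`, up to `‖u‖²`, then this form is bounded on `X`
independently of its a priori bound. The proof compares `u` with `u - s T u` for `u` near a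
maximiser of `‖W u‖ / ‖u‖` and small `s > 0`. -/
lemma norm_sq_le_of_lyapunov {F : Type*} [NormedAddCommGroup F] [InnerProductSpace ℂ F]
    {X : Submodule ℂ E} {W : E →L[ℂ] F} {T : E →L[ℂ] E} {c D : ℝ} (hc : 0 < c) (hD : 0 ≤ D)
    (hTX : ∀ u ∈ X, T u ∈ X) (hT : ∀ u ∈ X, 0 ≤ RCLike.re ⟪T u, u⟫_ℂ)
    (hW : ∀ u ∈ X, RCLike.re ⟪W u, W (T u)⟫_ℂ ≤ -c * ‖W u‖ ^ 2 + D * ‖u‖ ^ 2)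
    {u : E} (hu : u ∈ X) : ‖W u‖ ^ 2 ≤ D / c * ‖u‖ ^ 2 := by
  set n : ℝ := ‖W ∘L X.subtypeL‖ with hn
  have hn0 : 0 ≤ n := ContinuousLinearMap.opNorm_nonneg _
  have hWn : ∀ v ∈ X, ‖W v‖ ≤ n * ‖v‖ := fun v hv => (W ∘L X.subtypeL).le_opNorm ⟨v, hv⟩
  have h1 : ∀ s > 0, ∀ v ∈ X,
      (1 + 2 * s * c) * ‖W v‖ ^ 2 ≤ (n ^ 2 * (1 + s ^ 2 * ‖T‖ ^ 2) + 2 * s * D) * ‖v‖ ^ 2 := by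
    intro s hs v hv
    set w := v - (s : ℂ) • T v with hw
    have hwX : w ∈ X := X.sub_mem hv (X.smul_mem _ (hTX v hv))
    have e1 : ‖W w‖ ^ 2 = ‖W v‖ ^ 2 - 2 * s * RCLike.re ⟪W v, W (T v)⟫_ℂ
        + s ^ 2 * ‖W (T v)‖ ^ 2 := by
      rw [hw, map_sub, map_smul, norm_sub_sq (𝕜 := ℂ), inner_smul_right, norm_smul, mul_pow]
      simp only [RCLike.re_to_complex, Complex.re_ofReal_mul, Complex.norm_real, Real.norm_eq_abs,
        sq_abs]
      ring
    have e2 : ‖w‖ ^ 2 = ‖v‖ ^ 2 - 2 * s * RCLike.re ⟪T v, v⟫_ℂ + s ^ 2 * ‖T v‖ ^ 2 := by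
      rw [hw, norm_sub_sq (𝕜 := ℂ), inner_smul_right, norm_smul, mul_pow,
        ← inner_conj_symm v (T v)]
      simp only [RCLike.re_to_complex, Complex.re_ofReal_mul, Complex.norm_real, Real.norm_eq_abs,
        sq_abs, Complex.conj_re]
      ring
    have e3 : ‖W w‖ ^ 2 ≤ n ^ 2 * ‖w‖ ^ 2 := by
      rw [← mul_pow]
      exact pow_le_pow_left₀ (norm_nonneg _) (hWn w hwX) 2
    have e4 : ‖T v‖ ^ 2 ≤ ‖T‖ ^ 2 * ‖v‖ ^ 2 := by
      rw [← mul_pow]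
      exact pow_le_pow_left₀ (norm_nonneg _) (T.le_opNorm v) 2
    have e5 : ‖w‖ ^ 2 ≤ (1 + s ^ 2 * ‖T‖ ^ 2) * ‖v‖ ^ 2 := by
      have := mul_nonneg hs.le (hT v hv)
      have := mul_le_mul_of_nonneg_left e4 (sq_nonneg s)
      rw [e2]
      linarith
    have e6 := mul_le_mul_of_nonneg_left e5 (sq_nonneg n)
    have e7 := mul_le_mul_of_nonneg_left (hW v hv) hs.le
    have e8 : 0 ≤ s ^ 2 * ‖W (T v)‖ ^ 2 := by positivity
    linarith
  have h2 : ∀ s > 0, (1 + 2 * s * c) * n ^ 2 ≤ n ^ 2 * (1 + s ^ 2 * ‖T‖ ^ 2) + 2 * s * D := by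
    intro s hs
    have hp : 0 < 1 + 2 * s * c := by positivity
    set A := n ^ 2 * (1 + s ^ 2 * ‖T‖ ^ 2) + 2 * s * D with hA
    have hA0 : 0 ≤ A := by positivity
    have h3 : n ≤ √(A / (1 + 2 * s * c)) := by
      refine ContinuousLinearMap.opNorm_le_bound _ (Real.sqrt_nonneg _) fun v => ?_
      have h4 := h1 s hs v v.2
      change ‖W v‖ ≤ _ * ‖(v : E)‖
      rw [← Real.sqrt_sq (norm_nonneg (v : E)), ← Real.sqrt_mul (by positivity)]
      apply Real.le_sqrt_of_sq_le
      rw [div_mul_eq_mul_div, le_div_iff₀ hp]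
      linarith
    have h5 := (Real.le_sqrt hn0 (by positivity)).1 h3
    rw [le_div_iff₀ hp] at h5
    linarith
  have h3 : n ^ 2 * c ≤ D := by
    have h4 : ∀ s > 0, n ^ 2 * c ≤ D + s * (n ^ 2 * ‖T‖ ^ 2 / 2) := by
      intro s hs
      have := h2 s hs
      have : s * (n ^ 2 * c) ≤ s * (D + s * (n ^ 2 * ‖T‖ ^ 2 / 2)) := by linarith
      exact le_of_mul_le_mul_left this hs
    have h5 : Tendsto (fun s : ℝ => D + s * (n ^ 2 * ‖T‖ ^ 2 / 2)) (𝓝[>] 0) (𝓝 D) := by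
      have : Continuous fun s : ℝ => D + s * (n ^ 2 * ‖T‖ ^ 2 / 2) := by fun_prop
      have := this.tendsto 0
      simp only [zero_mul, add_zero] at this
      exact this.mono_left nhdsWithin_le_nhds
    exact ge_of_tendsto h5 (eventually_nhdsWithin_of_forall h4)
  calc ‖W u‖ ^ 2 ≤ (n * ‖u‖) ^ 2 := pow_le_pow_left₀ (norm_nonneg _) (hWn u hu) 2
    _ = n ^ 2 * ‖u‖ ^ 2 := mul_pow _ _ _
    _ ≤ _ := by
      gcongr
      rwa [le_div_iff₀ hc]

variable [CompleteSpace E] {R : E →L[ℂ] E}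

lemma resolvent_mem_ker_cfc (hR : IsSelfAdjoint R) {f : ℝ → ℝ} {u : E}
    (hu : u ∈ (cfc f R).ker) : R u ∈ (cfc f R).ker := by
  have h := (cfc_commute_cfc f id R).eq
  rw [cfc_id ℝ R] at h
  have h2 : cfc f R (R u) = R (cfc f R u) := congrArg (fun A : E →L[ℂ] E => A u) h
  rw [LinearMap.mem_ker] at hu ⊢
  exact h2.trans ((congrArg R hu).trans (map_zero R))

lemma resolvent_mem_ker_cfc_orthogonal (hR : IsSelfAdjoint R) {f : ℝ → ℝ} {u : E}
    (hu : u ∈ (cfc f R).kerᗮ) : R u ∈ (cfc f R).kerᗮ := by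
  rw [Submodule.mem_orthogonal] at hu ⊢
  intro v hv
  have h := ContinuousLinearMap.isSelfAdjoint_iff_isSymmetric.1 hR v u
  simp only [ContinuousLinearMap.coe_coe] at h
  rw [← h]
  exact hu _ (resolvent_mem_ker_cfc hR hv)

/-- The positive and negative parts of `R - b`. -/
lemma sub_smul_eq_cfc_sub (hR : IsSelfAdjoint R) (b : ℝ) (u : E) :
    R u - (b : ℂ) • u
      = cfc (fun t : ℝ => max (t - b) 0) R u - cfc (fun t : ℝ => max (b - t) 0) R u := by
  have h1 : R - algebraMap ℝ (E →L[ℂ] E) b = cfc (fun t : ℝ => t - b) R := by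
    rw [cfc_sub (fun t : ℝ => t) (fun _ => b) R, cfc_id' ℝ R, cfc_const b R]
  have h2 : cfc (fun t : ℝ => t - b) R
      = cfc (fun t : ℝ => max (t - b) 0) R - cfc (fun t : ℝ => max (b - t) 0) R := by
    rw [← cfc_sub _ _ R]
    congr 1
    ext t
    rcases le_total t b with h | h
    · rw [max_eq_right (by linarith), max_eq_left (by linarith)]; ring
    · rw [max_eq_left (by linarith), max_eq_right (by linarith)]; ring
  have h3 := congrArg (fun A : E →L[ℂ] E => A u) (h1.trans h2)
  exact h3

lemma re_inner_cfc_nonneg {g : ℝ → ℝ} (hg : ∀ t, 0 ≤ g t) (u : E) :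
    0 ≤ RCLike.re ⟪cfc g R u, u⟫_ℂ := by
  have h : 0 ≤ cfc g R := cfc_nonneg fun t _ => hg t
  exact ((ContinuousLinearMap.nonneg_iff_isPositive _).1 h).re_inner_nonneg_left u

lemma re_inner_sub_nonneg_of_mem_ker (hR : IsSelfAdjoint R) {b : ℝ} {u : E}
    (hu : u ∈ (cfc (fun t : ℝ => max (b - t) 0) R).ker) :
    0 ≤ RCLike.re ⟪R u - (b : ℂ) • u, u⟫_ℂ := by
  have hu' : cfc (fun t : ℝ => max (b - t) 0) R u = 0 := hu
  rw [sub_smul_eq_cfc_sub hR, hu', sub_zero]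
  exact re_inner_cfc_nonneg (fun t => le_max_right _ _) u

lemma re_inner_sub_nonpos_of_mem_ker_orthogonal (hR : IsSelfAdjoint R) {b : ℝ} {u : E}
    (hu : u ∈ (cfc (fun t : ℝ => max (b - t) 0) R).kerᗮ) :
    RCLike.re ⟪R u - (b : ℂ) • u, u⟫_ℂ ≤ 0 := by
  -- The positive part of `R - b` maps into the kernel of the negative part, as their product is 0.
  have hmem : cfc (fun t : ℝ => max (t - b) 0) R u
      ∈ (cfc (fun t : ℝ => max (b - t) 0) R).ker := by
    have h : cfc (fun t : ℝ => max (b - t) 0) R * cfc (fun t : ℝ => max (t - b) 0) R = 0 := by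
      rw [← cfc_mul _ _ R, ← cfc_const_zero ℝ R]
      congr 1
      ext t
      rcases le_total t b with h | h
      · rw [max_eq_right (by linarith : t - b ≤ 0), mul_zero]
      · rw [max_eq_right (by linarith : b - t ≤ 0), zero_mul]
    exact congrArg (fun A : E →L[ℂ] E => A u) h
  have h0 := (Submodule.mem_orthogonal _ _).1 hu _ hmem
  rw [sub_smul_eq_cfc_sub hR, inner_sub_left, h0, zero_sub, map_neg, neg_nonpos]
  exact re_inner_cfc_nonneg (fun t => le_max_right _ _) u

end Abstract

/-! ### Exponential weights -/

section

variable {N L : ℝ} {V ψ : ℂ → ℝ} {K : NNReal}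

lemma continuous_of_sub_le (hψ : ∀ x z, ψ x - ψ z ≤ L * ‖x - z‖) : Continuous ψ := by
  have : LipschitzWith L.toNNReal ψ := LipschitzWith.of_le_add_mul' L fun x z => by
    rw [dist_eq_norm]
    linarith [hψ x z]
  exact this.continuous

lemma memLp_expWeight (hψ : ∀ x z, ψ x - ψ z ≤ L * ‖x - z‖) {C : ℝ} (hC : ∀ z, |ψ z| ≤ C) (s : ℝ) :
    MemLp (fun z => ((Real.exp (s * ψ z) : ℝ) : ℂ)) ∞ planeMeasure := by
  have := continuous_of_sub_le hψ
  refine memLp_top_ofReal (φ := fun z => Real.exp (s * ψ z)) (by fun_prop)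
    (C := Real.exp (|s| * C)) fun z => ?_
  rw [Real.abs_exp]
  apply Real.exp_le_exp.2
  calc s * ψ z ≤ |s * ψ z| := le_abs_self _
    _ = |s| * |ψ z| := abs_mul _ _
    _ ≤ _ := by gcongr; exact hC z

/-- On the Fock--Bargmann space the resolvent `(H_N + 1)⁻¹` is close to multiplication by
`(1 + V)⁻¹`, also in exponentially weighted norms. -/
lemma norm_weight_resolvent_sub_le (hN : 1 ≤ N) (hV : ∀ z, 0 < V z)
    (hLip : LipschitzWith K fun z => Real.log (V z)) (hVc : Continuous V)
    {R : fock N →L[ℂ] fock N} (hR : IsResolventNegOne (toeplitz N V) R)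
    (hψ : ∀ x z, ψ x - ψ z ≤ L * ‖x - z‖)
    (hW : MemLp (fun z => ((Real.exp (√N * ψ z) : ℝ) : ℂ)) ∞ planeMeasure) (u : fock N) :
    ‖boundedMul hW (R u) - boundedMul hW (boundedMul (memLp_resolventSymbol hV hVc) (u : PlaneL2))‖
      ≤ commutatorBound N L K * ‖boundedMul hW (R u)‖ := by
  have hN0 : 0 < N := by linarith
  obtain ⟨hd, hu⟩ := hR.1 u
  set f := R u with hf
  have hfd : MemLp (fun z => (V z : ℂ) * (f : PlaneL2) z) 2 planeMeasure := hd
  have huc : (u : PlaneL2) =ᵐ[planeMeasure] fun x =>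
      (∫ z, ginibreKernel N x z * ((V z : ℂ) * (f : PlaneL2) z) ∂planeMeasure)
        + (f : PlaneL2) x := by
    have e : (u : PlaneL2) = (fock N).starProjection hfd.toLp + (f : PlaneL2) := by
      conv_lhs => rw [← hu]
      rfl
    rw [e]
    filter_upwards [Lp.coeFn_add ((fock N).starProjection hfd.toLp) (f : PlaneL2),
      coeFn_starProjection_fock_of_ae hN0 hfd.coeFn_toLp] with x h1 h2
    rw [h1, Pi.add_apply, h2]
  have hb := eLpNorm_weighted_le (N := N) (M := K * Real.exp ((K + L + 1) ^ 2) / √N)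
    (Φ := fun z => √N * ψ z) (h := (f : PlaneL2))
    (G := fun x => (f : PlaneL2) x - (((1 + V x)⁻¹ : ℝ) : ℂ) * (u : PlaneL2) x)
    hN0 (by positivity) (((continuous_of_sub_le hψ).measurable).const_mul _) (Lp.memLp _).1 ?_
  · refine norm_le_of_eLpNorm_le (commutatorBound_nonneg N L K) ?_ (coeFn_boundedMul hW _) hb
    filter_upwards [Lp.coeFn_sub (boundedMul hW f)
      (boundedMul hW (boundedMul (memLp_resolventSymbol hV hVc) (u : PlaneL2))),
      coeFn_boundedMul hW f,
      coeFn_boundedMul hW (boundedMul (memLp_resolventSymbol hV hVc) (u : PlaneL2)),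
      coeFn_boundedMul (memLp_resolventSymbol hV hVc) (u : PlaneL2)] with x h1 h2 h3 h4
    rw [h1, Pi.sub_apply, h2, h3, h4, mul_sub]
  · filter_upwards [huc, coeFn_fock hN0 f] with x hux hfx
    refine ⟨fun z => (((V x - V z) * (1 + V x)⁻¹ : ℝ) : ℂ) * ginibreKernel N x z, ?_, fun z => ?_⟩
    · have hi : Integrable (fun z => ginibreKernel N x z * ((V z : ℂ) * (f : PlaneL2) z))
          planeMeasure := by
        refine (integrable_ginibreKernel_mul hN0 x hfd.toLp).congr ?_
        filter_upwards [hfd.coeFn_toLp] with z hz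
        rw [hz]
      have hx0 : (1 + V x : ℂ) ≠ 0 := by
        have := hV x
        exact_mod_cast (by positivity : 1 + V x ≠ 0)
      have e : (f : PlaneL2) x - (((1 + V x)⁻¹ : ℝ) : ℂ) * (u : PlaneL2) x
          = ((1 + V x : ℂ))⁻¹ * ((V x : ℂ) * (f : PlaneL2) x -
            ∫ z, ginibreKernel N x z * ((V z : ℂ) * (f : PlaneL2) z) ∂planeMeasure) := by
        rw [hux]
        push_cast
        field_simp
        ring
      rw [e]
      conv_lhs => rw [hfx]
      rw [← integral_const_mul, ← integral_sub
        ((integrable_ginibreKernel_mul hN0 x f).const_mul _) hi, ← integral_const_mul]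
      congr 1
      ext z
      push_cast
      ring
    · refine weighted_kernel_le_of_small hN K hψ x z ?_
      have h1 := abs_sub_le_of_lipschitz_log hV hLip x z
      have hx := hV x
      rw [abs_mul, abs_of_pos (by positivity : 0 < (1 + V x)⁻¹), ← div_eq_mul_inv,
        div_le_iff₀ (by positivity)]
      refine h1.trans ?_
      have : 0 ≤ K * ‖x - z‖ * Real.exp (K * ‖x - z‖) := by positivity
      nlinarith

/-- If `ψ` vanishes where `σ ((1 + V)⁻¹ - b)` is not at most `-c`, the multiplication operator
`σ ((1 + V)⁻¹ - b)` is negative in the weighted norm, up to an unweighted remainder. -/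
lemma re_inner_weight_symbol_le (hV : ∀ z, 0 < V z) (hVc : Continuous V)
    (hW : MemLp (fun z => ((Real.exp (√N * ψ z) : ℝ) : ℂ)) ∞ planeMeasure)
    (hψ0 : ∀ z, 0 ≤ ψ z) {b c σ : ℝ} (hb0 : 0 ≤ b) (hb1 : b ≤ 1) (hc : 0 ≤ c) (hσ : |σ| = 1)
    (hsign : ∀ z, 0 < ψ z → σ * ((1 + V z)⁻¹ - b) ≤ -c) (u : PlaneL2) :
    σ * (⟪boundedMul hW u, boundedMul hW (boundedMul (memLp_resolventSymbol hV hVc) u)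
        - (b : ℂ) • boundedMul hW u⟫_ℂ).re ≤ -c * ‖boundedMul hW u‖ ^ 2 + (1 + c) * ‖u‖ ^ 2 := by
  set w := boundedMul hW u with hw
  have hcont : Continuous fun z => (1 + V z)⁻¹ - b :=
    (hVc.const_add 1 |>.inv₀ fun z => by linarith [hV z]).sub continuous_const
  have hab : ∀ z, |(1 + V z)⁻¹ - b| ≤ 1 := by
    intro z
    have := hV z
    have h1 : (1 + V z)⁻¹ ≤ 1 := inv_le_one_of_one_le₀ (by linarith)
    have h2 : 0 < (1 + V z)⁻¹ := by positivity
    rw [abs_le]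
    constructor <;> linarith
  have hint : Integrable (fun z => ((1 + V z)⁻¹ - b) * ‖w z‖ ^ 2) planeMeasure :=
    (integrable_norm_sq w).bdd_mul hcont.aestronglyMeasurable
      (ae_of_all _ fun z => by rw [Real.norm_eq_abs]; exact hab z)
  have e : ⟪w, boundedMul hW (boundedMul (memLp_resolventSymbol hV hVc) u) - (b : ℂ) • w⟫_ℂ
      = ((∫ z, ((1 + V z)⁻¹ - b) * ‖w z‖ ^ 2 ∂planeMeasure : ℝ) : ℂ) := by
    rw [L2.inner_def, ← integral_complex_ofReal]
    apply integral_congr_ae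
    filter_upwards [Lp.coeFn_sub (boundedMul hW (boundedMul (memLp_resolventSymbol hV hVc) u))
      ((b : ℂ) • w), Lp.coeFn_smul (b : ℂ) w,
      coeFn_boundedMul hW (boundedMul (memLp_resolventSymbol hV hVc) u),
      coeFn_boundedMul (memLp_resolventSymbol hV hVc) u, coeFn_boundedMul hW u] with z h1 h2 h3 h4 h5
    have h6 : (boundedMul hW (boundedMul (memLp_resolventSymbol hV hVc) u) - (b : ℂ) • w : PlaneL2) z
        = (((1 + V z)⁻¹ - b : ℝ) : ℂ) * w z := by
      rw [h1, Pi.sub_apply, h2, Pi.smul_apply, h3, h4, smul_eq_mul, hw, h5]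
      push_cast
      ring
    rw [h6, RCLike.inner_apply, mul_assoc, Complex.mul_conj']
    push_cast
    ring
  rw [e, Complex.ofReal_re, ← integral_const_mul, norm_sq_eq_integral w, norm_sq_eq_integral u,
    ← integral_const_mul, ← integral_const_mul, ← integral_add
    ((integrable_norm_sq w).const_mul _) ((integrable_norm_sq u).const_mul _)]
  refine integral_mono_ae (hint.const_mul σ) (((integrable_norm_sq w).const_mul _).add
    ((integrable_norm_sq u).const_mul _)) ?_
  filter_upwards [coeFn_boundedMul hW u] with z hz
  rw [← mul_assoc]
  rcases (hψ0 z).eq_or_lt with h0 | h0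
  · have : ‖w z‖ ^ 2 = ‖u z‖ ^ 2 := by
      rw [hw, hz, ← h0]
      simp
    rw [this]
    have h1 : σ * ((1 + V z)⁻¹ - b) ≤ 1 := by
      refine (le_abs_self _).trans ?_
      rw [abs_mul, hσ, one_mul]
      exact hab z
    nlinarith [sq_nonneg ‖u z‖]
  · have h1 := hsign z h0
    nlinarith [sq_nonneg ‖u z‖, sq_nonneg ‖w z‖]

/-- Weighted `L²` bound for spectral subspaces: `X` is `𝟏{H_N ≤ μ}` (`σ = 1`) or its complement
(`σ = -1`), described through the resolvent `R` and `b = (1 + μ)⁻¹`, and the weight is supported in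
the classically forbidden region. -/
lemma norm_sq_weight_le_of_forbidden (hN : 1 ≤ N) (hV : ∀ z, 0 < V z)
    (hLip : LipschitzWith K fun z => Real.log (V z))
    {R : fock N →L[ℂ] fock N} (hR : IsResolventNegOne (toeplitz N V) R)
    (hψ : ∀ x z, ψ x - ψ z ≤ L * ‖x - z‖)
    (hW : MemLp (fun z => ((Real.exp (√N * ψ z) : ℝ) : ℂ)) ∞ planeMeasure)
    (hψ0 : ∀ z, 0 ≤ ψ z) {b c σ : ℝ} (hb0 : 0 ≤ b) (hb1 : b ≤ 1) (hc : 0 < c) (hc1 : c ≤ 1)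
    (hσ : |σ| = 1)
    (hsign : ∀ z, 0 < ψ z → σ * ((1 + V z)⁻¹ - b) ≤ -c)
    (hsmall : commutatorBound N L K ≤ c / 4)
    {X : Submodule ℂ (fock N)} (hRX : ∀ u ∈ X, R u ∈ X)
    (hX : ∀ u ∈ X, 0 ≤ σ * RCLike.re ⟪R u - (b : ℂ) • u, u⟫_ℂ) {u : fock N} (hu : u ∈ X) :
    ‖boundedMul hW (u : PlaneL2)‖ ^ 2 ≤ 4 / c * ‖u‖ ^ 2 := by
  have hVc := continuous_of_lipschitz_log hV hLip
  set W : fock N →L[ℂ] PlaneL2 := boundedMul hW ∘L (fock N).subtypeL with hWdef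
  have hWa : ∀ v : fock N, W v = boundedMul hW (v : PlaneL2) := fun v => rfl
  set T : fock N →L[ℂ] fock N := (σ : ℂ) • (R - (b : ℂ) • ContinuousLinearMap.id ℂ (fock N))
    with hT
  have hTa : ∀ v, T v = (σ : ℂ) • (R v - (b : ℂ) • v) := fun v => rfl
  have key := norm_sq_le_of_lyapunov (X := X) (W := W) (T := T) (c := c / 2) (D := 2) (by positivity)
    (by norm_num) ?_ ?_ ?_ hu
  · rw [hWa] at key
    refine key.trans (le_of_eq ?_)
    congr 1
    field_simp
    norm_num
  · intro v hv
    rw [hTa]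
    exact X.smul_mem _ (X.sub_mem (hRX v hv) (X.smul_mem _ hv))
  · intro v hv
    have h1 : ⟪(σ : ℂ) • (R v - (b : ℂ) • v), v⟫_ℂ
        = (starRingEnd ℂ) (σ : ℂ) * ⟪R v - (b : ℂ) • v, v⟫_ℂ :=
      inner_smul_left (𝕜 := ℂ) (E := fock N) (R v - (b : ℂ) • v) v (σ : ℂ)
    rw [hTa, h1, Complex.conj_ofReal, RCLike.re_to_complex, Complex.re_ofReal_mul]
    exact hX v hv
  · intro v _
    set A := boundedMul hW (boundedMul (memLp_resolventSymbol hV hVc) (v : PlaneL2)) with hA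
    have hcomm := norm_weight_resolvent_sub_le hN hV hLip hVc hR hψ hW v
    rw [← hA, ← hWa (R v)] at hcomm
    have hAW : ‖A‖ ≤ ‖W v‖ := by
      apply Lp.norm_le_norm_of_ae_le
      filter_upwards [coeFn_boundedMul hW
        (boundedMul (memLp_resolventSymbol hV hVc) (v : PlaneL2)),
        coeFn_boundedMul (memLp_resolventSymbol hV hVc) (v : PlaneL2),
        coeFn_boundedMul hW (v : PlaneL2)] with z h1 h2 h3
      rw [hA, hWa, h1, h2, h3, norm_mul, norm_mul, norm_mul]
      have hz := hV z
      have : ‖(((1 + V z)⁻¹ : ℝ) : ℂ)‖ ≤ 1 := by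
        rw [Complex.norm_real, Real.norm_eq_abs, abs_of_pos (by positivity)]
        exact inv_le_one_of_one_le₀ (by linarith)
      gcongr
      exact mul_le_of_le_one_left (norm_nonneg _) this
    have hRv : ‖W (R v)‖ ≤ 2 * ‖W v‖ := by
      have h1 := norm_le_norm_add_norm_sub A (W (R v))
      rw [norm_sub_rev] at h1
      nlinarith [norm_nonneg (W (R v))]
    have hsub : ‖W (R v) - A‖ ≤ c / 2 * ‖W v‖ := by
      refine hcomm.trans ?_
      calc _ ≤ c / 4 * (2 * ‖W v‖) := by gcongr
        _ = _ := by ring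
    have hsym := re_inner_weight_symbol_le hV hVc hW hψ0 hb0 hb1 hc.le hσ hsign (v : PlaneL2)
    rw [← hA, ← hWa] at hsym
    have e : W (T v) = (σ : ℂ) • ((A - (b : ℂ) • W v) + (W (R v) - A)) := by
      rw [hTa, map_smul, map_sub, map_smul]
      congr 1
      abel
    rw [e, inner_smul_right, inner_add_right, RCLike.re_to_complex, Complex.re_ofReal_mul,
      Complex.add_re, mul_add]
    have h3 : σ * (⟪W v, W (R v) - A⟫_ℂ).re ≤ ‖W v‖ * (c / 2 * ‖W v‖) := by
      refine (le_abs_self _).trans ?_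
      rw [abs_mul, hσ, one_mul]
      refine (Complex.abs_re_le_norm _).trans ((norm_inner_le_norm _ _).trans ?_)
      gcongr
    have h4 : (1 + c) * ‖(v : PlaneL2)‖ ^ 2 ≤ 2 * ‖v‖ ^ 2 := by
      change (1 + c) * ‖v‖ ^ 2 ≤ _
      gcongr
      linarith
    linarith

/-- The coherent state at `x` in the Hilbert space `𝓑_N`. -/
def fockCoherent (hN : 0 < N) (x : ℂ) : fock N := ⟨coherent hN x, coherent_mem_fock hN x⟩

/-- Point values are controlled by weighted norms, with the weight at the point. -/
lemma norm_inner_coherent_le (hN : 1 ≤ N) (hψ : ∀ x z, ψ x - ψ z ≤ L * ‖x - z‖)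
    {C : ℝ} (hC : ∀ z, |ψ z| ≤ C)
    (hW : MemLp (fun z => ((Real.exp (√N * ψ z) : ℝ) : ℂ)) ∞ planeMeasure) (x : ℂ) (u : PlaneL2) :
    ‖⟪coherent (zero_lt_one.trans_le hN) x, u⟫_ℂ‖
      ≤ Real.exp (-(√N * ψ x)) * (Real.exp ((L + 1) ^ 2) * √(2 * N)) * ‖boundedMul hW u‖ := by
  have hN0 : 0 < N := zero_lt_one.trans_le hN
  set W' := memLp_expWeight hψ hC (-√N) with hW'
  set k := coherent hN0 x with hk
  have e : ⟪k, u⟫_ℂ = ⟪boundedMul W' k, boundedMul hW u⟫_ℂ := by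
    rw [L2.inner_def, L2.inner_def]
    apply integral_congr_ae
    filter_upwards [coeFn_boundedMul W' k, coeFn_boundedMul hW u] with z h1 h2
    rw [h1, h2, RCLike.inner_apply, RCLike.inner_apply, map_mul, Complex.conj_ofReal]
    have : (Real.exp (√N * ψ z) : ℂ) * (Real.exp (-√N * ψ z) : ℂ) = 1 := by
      rw [← Complex.ofReal_mul, ← Real.exp_add]
      simp
    linear_combination (-(u z) * (starRingEnd ℂ) (k z)) * this
  rw [e]
  refine (norm_inner_le_norm _ _).trans ?_
  gcongr
  set B := Real.exp ((L + 1) ^ 2) with hB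
  have hpt : ∀ᵐ z ∂planeMeasure, ‖boundedMul W' k z‖ ^ 2 ≤ Real.exp (-(√N * ψ x)) ^ 2 * B ^ 2 *
      (N ^ 2 * Real.exp (-(N / 2) * ‖z - x‖ ^ 2)) := by
    filter_upwards [coeFn_boundedMul W' k, coeFn_coherent hN0 x] with z h1 h2
    have h3 := weighted_kernel_le hN 0 hψ x z (q := 1) (by simp)
    rw [Complex.ofReal_one, one_mul, NNReal.coe_zero, zero_add, gaussianKernel, ← hB,
      ← conj_ginibreKernel, RCLike.norm_conj, norm_sub_rev] at h3
    rw [h1, hk, h2, norm_mul, Complex.norm_real, Real.norm_eq_abs, Real.abs_exp]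
    have h4 : Real.exp (-√N * ψ z) * ‖ginibreKernel N z x‖
        = Real.exp (-(√N * ψ x)) * (Real.exp (√N * ψ x - √N * ψ z) * ‖ginibreKernel N z x‖) := by
      rw [← mul_assoc, ← Real.exp_add]
      congr 2
      ring
    rw [h4]
    calc _ ≤ (Real.exp (-(√N * ψ x)) * (B * (N * Real.exp (-(N / 4) * ‖z - x‖ ^ 2)))) ^ 2 := by
          gcongr
      _ = _ := by
          rw [mul_pow, mul_pow, mul_pow, ← Real.exp_nat_mul _ 2, mul_assoc]
          congr 4
          rw [← Real.exp_nat_mul]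
          congr 1
          push_cast
          ring
  apply abs_le_of_sq_le_sq' _ (by positivity) |>.2
  rw [norm_sq_eq_integral, mul_pow, mul_pow, Real.sq_sqrt (by positivity)]
  have hig : Integrable (fun z : ℂ => Real.exp (-(N / 2) * ‖z - x‖ ^ 2)) planeMeasure :=
    (integrable_gaussian_planeMeasure (b := N / 2) (by positivity)).comp_sub_right x
  calc _ ≤ ∫ z, Real.exp (-(√N * ψ x)) ^ 2 * B ^ 2 *
        (N ^ 2 * Real.exp (-(N / 2) * ‖z - x‖ ^ 2)) ∂planeMeasure :=
        integral_mono_ae (integrable_norm_sq _) ((hig.const_mul _).const_mul _) hpt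
    _ = _ := by
        rw [integral_const_mul, integral_const_mul,
          integral_sub_right_eq_self (fun z : ℂ => Real.exp (-(N / 2) * ‖z‖ ^ 2)) x,
          integral_gaussian_planeMeasure (by positivity)]
        field_simp

/-- Exponential decay, into the forbidden region, of the projection of a coherent state. -/
lemma norm_starProjection_coherent_le (hN : 1 ≤ N) (hV : ∀ z, 0 < V z)
    (hLip : LipschitzWith K fun z => Real.log (V z))
    {R : fock N →L[ℂ] fock N} (hR : IsResolventNegOne (toeplitz N V) R)
    (hψ : ∀ x z, ψ x - ψ z ≤ L * ‖x - z‖) (hψ0 : ∀ z, 0 ≤ ψ z)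
    {b c σ : ℝ} (hb0 : 0 ≤ b) (hb1 : b ≤ 1) (hc : 0 < c) (hc1 : c ≤ 1) (hσ : |σ| = 1)
    (hsign : ∀ z, 0 < ψ z → σ * ((1 + V z)⁻¹ - b) ≤ -c)
    (hsmall : commutatorBound N L K ≤ c / 4)
    {X : Submodule ℂ (fock N)} [X.HasOrthogonalProjection] (hRX : ∀ u ∈ X, R u ∈ X)
    (hX : ∀ u ∈ X, 0 ≤ σ * RCLike.re ⟪R u - (b : ℂ) • u, u⟫_ℂ) (x : ℂ) :
    ‖X.starProjection (fockCoherent (zero_lt_one.trans_le hN) x)‖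
      ≤ √N * Real.exp (-(√N * ψ x)) * (Real.exp ((L + 1) ^ 2) * √(8 / c)) := by
  -- Only the value of the weight at `x` matters, so it can be truncated at that value.
  set ψ' : ℂ → ℝ := fun z => min (ψ z) (ψ x) with hψ'
  have hL : 0 ≤ L := by
    have h1 := hψ 1 0
    have h2 := hψ 0 1
    simp at h1 h2
    linarith
  have hψ'L : ∀ y z, ψ' y - ψ' z ≤ L * ‖y - z‖ := by
    intro y z
    have h1 := hψ y z
    have h2 : 0 ≤ L * ‖y - z‖ := by positivity
    simp only [hψ']
    rcases min_choice (ψ z) (ψ x) with h | h <;> rw [h]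
    · linarith [min_le_left (ψ y) (ψ x)]
    · linarith [min_le_right (ψ y) (ψ x)]
  have hψ'0 : ∀ z, 0 ≤ ψ' z := fun z => le_min (hψ0 z) (hψ0 x)
  have hψ'b : ∀ z, |ψ' z| ≤ ψ x := fun z => by
    rw [abs_of_nonneg (hψ'0 z)]
    exact min_le_right _ _
  have hψ'x : ψ' x = ψ x := min_self _
  have hW := memLp_expWeight hψ'L hψ'b (√N)
  set k := fockCoherent (zero_lt_one.trans_le hN) x with hk
  set v := X.starProjection k with hv
  have hvX : v ∈ X := X.starProjection_apply_mem k
  have h1 := norm_sq_weight_le_of_forbidden hN hV hLip hR hψ'L hW hψ'0 hb0 hb1 hc hc1 hσ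
    (fun z hz => hsign z (hz.trans_le (min_le_left _ _))) hsmall hRX hX hvX
  have h2 : ‖boundedMul hW (v : PlaneL2)‖ ≤ √(4 / c) * ‖v‖ := by
    apply abs_le_of_sq_le_sq' _ (by positivity) |>.2
    rw [mul_pow, Real.sq_sqrt (by positivity)]
    exact h1
  have h3 := norm_inner_coherent_le hN hψ'L hψ'b hW x (v : PlaneL2)
  have h4 : ⟪coherent (zero_lt_one.trans_le hN) x, (v : PlaneL2)⟫_ℂ = ((‖v‖ ^ 2 : ℝ) : ℂ) := by
    change ⟪k, v⟫_ℂ = _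
    have : ⟪k, v⟫_ℂ = ⟪v, v⟫_ℂ := by
      conv_rhs => rw [hv]
      rw [Submodule.inner_starProjection_left_eq_right,
        Submodule.starProjection_eq_self_iff.2 (X.starProjection_apply_mem k)]
    rw [this, Complex.ofReal_pow]
    exact inner_self_eq_norm_sq_to_K v
  rw [h4, Complex.norm_real, Real.norm_eq_abs, abs_of_nonneg (by positivity), hψ'x] at h3
  have h5 : √(2 * N) * √(4 / c) = √N * √(8 / c) := by
    rw [← Real.sqrt_mul (by positivity), ← Real.sqrt_mul (by linarith)]
    congr 1
    ring
  have h6 : ‖v‖ * ‖v‖ ≤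
      (√N * Real.exp (-(√N * ψ x)) * (Real.exp ((L + 1) ^ 2) * √(8 / c))) * ‖v‖ := by
    calc ‖v‖ * ‖v‖ = ‖v‖ ^ 2 := (sq _).symm
      _ ≤ _ := h3
      _ ≤ Real.exp (-(√N * ψ x)) * (Real.exp ((L + 1) ^ 2) * √(2 * N)) * (√(4 / c) * ‖v‖) := by
        gcongr
      _ = Real.exp (-(√N * ψ x)) * Real.exp ((L + 1) ^ 2) * (√(2 * N) * √(4 / c)) * ‖v‖ := by ring
      _ = _ := by rw [h5]; ring
  rcases (norm_nonneg v).eq_or_lt with h0 | h0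
  · rw [← h0]; positivity
  · exact le_of_mul_le_mul_right h6 h0

end

/-! ### The kernel of the spectral projection -/

section

variable {N : ℝ} {V : ℂ → ℝ} {K : NNReal}

/-- The kernel `(x, z) ↦ ⟪k_x, Π k_z⟫` of the orthogonal projection `Π` onto a subspace `X` of
`𝓑_N`, where `k_x` is the coherent state at `x`. -/
def projectionKernel (hN : 0 < N) (X : Submodule ℂ (fock N)) [X.HasOrthogonalProjection]
    (x z : ℂ) : ℂ :=
  ⟪fockCoherent hN x, X.starProjection (fockCoherent hN z)⟫_ℂ

lemma projectionKernel_eq (hN : 0 < N) (X : Submodule ℂ (fock N)) [X.HasOrthogonalProjection]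
    (x z : ℂ) : projectionKernel hN X x z
      = ⟪X.starProjection (fockCoherent hN x), X.starProjection (fockCoherent hN z)⟫_ℂ := by
  rw [Submodule.inner_starProjection_left_eq_right,
    Submodule.starProjection_eq_self_iff.2 (X.starProjection_apply_mem _)]
  rfl

lemma norm_projectionKernel_le (hN : 0 < N) (X : Submodule ℂ (fock N))
    [X.HasOrthogonalProjection] (x z : ℂ) : ‖projectionKernel hN X x z‖
      ≤ ‖X.starProjection (fockCoherent hN x)‖ * ‖X.starProjection (fockCoherent hN z)‖ := by
  rw [projectionKernel_eq]
  exact norm_inner_le_norm (𝕜 := ℂ) (E := fock N) _ _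

lemma projectionKernel_add_orthogonal (hN : 0 < N) (X : Submodule ℂ (fock N))
    [X.HasOrthogonalProjection] (x z : ℂ) :
    projectionKernel hN X x z + projectionKernel hN Xᗮ x z = ginibreKernel N x z := by
  have h : X.starProjection (fockCoherent hN z) + Xᗮ.starProjection (fockCoherent hN z)
      = fockCoherent hN z := by
    rw [Submodule.starProjection_orthogonal']
    simp
  have h1 : projectionKernel hN X x z + projectionKernel hN Xᗮ x z
      = ⟪fockCoherent hN x, X.starProjection (fockCoherent hN z)
        + Xᗮ.starProjection (fockCoherent hN z)⟫_ℂ :=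
    (inner_add_right (𝕜 := ℂ) (E := fock N) _ _ _).symm
  rw [h1, h]
  exact inner_coherent_coherent hN x z

lemma continuous_fockCoherent (hN : 0 < N) : Continuous (fockCoherent hN) :=
  (continuous_coherent hN).subtype_mk _

lemma isContinuousKernel_projectionKernel (hN : 0 < N) (X : Submodule ℂ (fock N))
    [X.HasOrthogonalProjection] :
    IsContinuousKernel ((fock N).subtypeL ∘L X.starProjection ∘L
      (fock N).orthogonalProjectionOnto) (projectionKernel hN X) := by
  have hae : ∀ x, projectionKernel hN X x =ᵐ[planeMeasure] fun z =>
      (starRingEnd ℂ) ((X.starProjection (fockCoherent hN x) : PlaneL2) z) := by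
    intro x
    filter_upwards [coeFn_eq_inner_coherent hN (X.starProjection (fockCoherent hN x)).2] with z hz
    rw [hz, inner_conj_symm]
    exact (X.inner_starProjection_left_eq_right _ _).symm
  refine ⟨?_, fun x => ?_, fun f => ?_⟩
  · unfold projectionKernel
    have := continuous_fockCoherent hN
    exact (this.comp continuous_fst).inner
      (X.starProjection.continuous.comp (this.comp continuous_snd))
  · exact (memLp_congr_ae (hae x)).2 (Lp.memLp _).star
  · set v : fock N := X.starProjection ((fock N).orthogonalProjectionOnto f) with hv
    change (v : PlaneL2) =ᵐ[planeMeasure] _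
    filter_upwards [coeFn_eq_inner_coherent hN v.2] with x hx
    have h1 : ⟪coherent hN x, (v : PlaneL2)⟫_ℂ
        = ⟪(X.starProjection (fockCoherent hN x) : PlaneL2), f⟫_ℂ := by
      have h2 : ⟪coherent hN x, (v : PlaneL2)⟫_ℂ = ⟪X.starProjection (fockCoherent hN x),
          (fock N).orthogonalProjectionOnto f⟫_ℂ :=
        (X.inner_starProjection_left_eq_right (fockCoherent hN x) _).symm
      rw [h2]
      have h3 := (fock N).inner_starProjection_left_eq_right
        (X.starProjection (fockCoherent hN x) : PlaneL2) f
      rw [Submodule.starProjection_eq_self_iff.2 (X.starProjection (fockCoherent hN x)).2] at h3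
      exact h3.symm
    rw [hx, h1, L2.inner_def]
    apply integral_congr_ae
    filter_upwards [hae x] with z hz
    rw [hz, RCLike.inner_apply, mul_comm]

lemma norm_fockCoherent (hN : 0 < N) (x : ℂ) : ‖fockCoherent hN x‖ = √N := norm_coherent hN x

/-- Decay of projected coherent states with prefactor exactly `√N`. The function `g` is positive
only in the forbidden region and equals a constant `ℓ > 0` where `D > 0`; the factor
`exp (-√N ℓ)` it contributes there absorbs the constants. -/
lemma eventually_norm_starProjection_coherent_le (hV : ∀ z, 0 < V z)
    (hLip : LipschitzWith K fun z => Real.log (V z)) {α : ℝ} (hα : 0 < α) {D g : ℂ → ℝ}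
    (hD : LipschitzWith 1 D) (hD0 : ∀ z, 0 ≤ D z) (hg : LipschitzWith K g) (hg0 : ∀ z, 0 ≤ g z)
    {ℓ : ℝ} (hℓ : 0 < ℓ) (hDg : ∀ z, 0 < D z → g z = ℓ)
    {b c σ : ℝ} (hb0 : 0 ≤ b) (hb1 : b ≤ 1) (hc : 0 < c) (hc1 : c ≤ 1) (hσ : |σ| = 1)
    (hsign : ∀ z, 0 < g z → σ * ((1 + V z)⁻¹ - b) ≤ -c) :
    ∀ᶠ N in atTop, ∀ (hN : 1 ≤ N) (R : fock N →L[ℂ] fock N),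
      IsResolventNegOne (toeplitz N V) R →
      ∀ (X : Submodule ℂ (fock N)) [X.HasOrthogonalProjection], (∀ u ∈ X, R u ∈ X) →
      (∀ u ∈ X, 0 ≤ σ * RCLike.re ⟪R u - (b : ℂ) • u, u⟫_ℂ) → ∀ x,
      ‖X.starProjection (fockCoherent (zero_lt_one.trans_le hN) x)‖
        ≤ √N * Real.exp (-α * √N * D x) := by
  have h1 : ∀ᶠ N in atTop, commutatorBound N (α + K) K ≤ c / 4 :=
    (tendsto_commutatorBound (α + K) K).eventually_le_const (by positivity)
  have h2 : ∀ᶠ N : ℝ in atTop,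
      Real.exp (-(√N * ℓ)) * (Real.exp ((α + K + 1) ^ 2) * √(8 / c)) ≤ 1 := by
    have : Tendsto (fun N : ℝ => Real.exp (-(√N * ℓ)) *
        (Real.exp ((α + K + 1) ^ 2) * √(8 / c))) atTop (𝓝 0) := by
      rw [← zero_mul (Real.exp ((α + K + 1) ^ 2) * √(8 / c))]
      exact (Real.tendsto_exp_neg_atTop_nhds_zero.comp
        (Real.tendsto_sqrt_atTop.atTop_mul_const hℓ)).mul_const _
    exact this.eventually_le_const one_pos
  filter_upwards [h1, h2] with N hN1 hN2 hN R hR X _ hRX hX x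
  rcases (hD0 x).eq_or_lt with h0 | h0
  · rw [← h0, mul_zero, Real.exp_zero, mul_one]
    exact (X.norm_starProjection_apply_le _).trans (norm_fockCoherent _ x).le
  · set ψ : ℂ → ℝ := fun z => α * D z + g z with hψ
    have hψL : ∀ y z, ψ y - ψ z ≤ (α + K) * ‖y - z‖ := by
      intro y z
      have e1 := hD.dist_le_mul y z
      have e2 := hg.dist_le_mul y z
      rw [Real.dist_eq, dist_eq_norm] at e1 e2
      have e3 := mul_le_mul_of_nonneg_left ((le_abs_self _).trans e1) hα.le
      have e4 := (le_abs_self _).trans e2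
      rw [NNReal.coe_one, one_mul] at e3
      simp only [hψ]
      linarith
    have hgpos : ∀ z, 0 < ψ z → 0 < g z := by
      intro z hz
      rcases (hD0 z).eq_or_lt with h | h
      · simpa [hψ, ← h] using hz
      · rw [hDg z h]; exact hℓ
    have h3 := norm_starProjection_coherent_le hN hV hLip hR hψL
      (fun z => add_nonneg (mul_nonneg hα.le (hD0 z)) (hg0 z)) hb0 hb1 hc hc1 hσ
      (fun z hz => hsign z (hgpos z hz)) hN1 hRX hX x
    refine h3.trans ?_
    have e : Real.exp (-(√N * ψ x)) = Real.exp (-α * √N * D x) * Real.exp (-(√N * ℓ)) := by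
      rw [← Real.exp_add, hψ]
      simp only [hDg x h0]
      congr 1
      ring
    rw [e]
    calc _ = √N * Real.exp (-α * √N * D x) *
          (Real.exp (-(√N * ℓ)) * (Real.exp ((α + K + 1) ^ 2) * √(8 / c))) := by ring
      _ ≤ √N * Real.exp (-α * √N * D x) * 1 := by gcongr
      _ = _ := mul_one _

lemma lipschitzWith_clamp {F : ℂ → ℝ} (hF : LipschitzWith K F) (ℓ : ℝ) :
    LipschitzWith K fun z => min (max (F z) 0) ℓ :=
  (hF.max_const 0).min_const ℓ

lemma mul_le_of_sqrt_bounds (hN : 0 ≤ N) {α A B d e : ℝ} (hB0 : 0 ≤ B)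
    (hA : A ≤ √N * Real.exp (-α * √N * d)) (hB : B ≤ √N * Real.exp (-α * √N * e)) :
    A * B ≤ N * Real.exp (-α * √N * (d + e)) := by
  calc A * B ≤ (√N * Real.exp (-α * √N * d)) * (√N * Real.exp (-α * √N * e)) :=
        mul_le_mul hA hB hB0 (by positivity)
    _ = _ := by
        rw [mul_mul_mul_comm, Real.mul_self_sqrt hN, ← Real.exp_add]
        ring_nf

/-- States below energy `μ` are small where `V > μ + δ`. -/
lemma eventually_norm_starProjection_le_above (hV : ∀ z, 0 < V z)
    (hLip : LipschitzWith K fun z => Real.log (V z)) {μ α δ : ℝ} (hμ : 0 < μ) (hα : 0 < α)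
    (hδ : 0 < δ) :
    ∀ᶠ N in atTop, ∀ (hN : 1 ≤ N) (R : fock N →L[ℂ] fock N),
      IsResolventNegOne (toeplitz N V) R →
      ∀ (X : Submodule ℂ (fock N)) [X.HasOrthogonalProjection], (∀ u ∈ X, R u ∈ X) →
      (∀ u ∈ X, 0 ≤ RCLike.re ⟪R u - (((1 + μ)⁻¹ : ℝ) : ℂ) • u, u⟫_ℂ) → ∀ x,
      ‖X.starProjection (fockCoherent (zero_lt_one.trans_le hN) x)‖
        ≤ √N * Real.exp (-α * √N * Metric.infDist x {w | V w ≤ μ + δ}) := by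
  set ℓ := Real.log (μ + δ) - Real.log (μ + δ / 2) with hℓ
  have hℓ0 : 0 < ℓ := sub_pos.2 (Real.log_lt_log (by linarith) (by linarith))
  set g : ℂ → ℝ := fun z => min (max (Real.log (V z) - Real.log (μ + δ / 2)) 0) ℓ with hg
  have hc : 0 < (1 + μ)⁻¹ - (1 + (μ + δ / 2))⁻¹ :=
    sub_pos.2 (inv_strictAnti₀ (by linarith) (by linarith))
  have hb1 : (1 + μ)⁻¹ ≤ 1 := inv_le_one_of_one_le₀ (by linarith)
  have hp : 0 < (1 + (μ + δ / 2))⁻¹ := inv_pos.2 (by linarith)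
  have key := eventually_norm_starProjection_coherent_le hV hLip hα
    (D := fun x => Metric.infDist x {w | V w ≤ μ + δ}) (g := g) (ℓ := ℓ) (b := (1 + μ)⁻¹)
    (c := (1 + μ)⁻¹ - (1 + (μ + δ / 2))⁻¹) (σ := 1) (Metric.lipschitz_infDist_pt _)
    (fun _ => Metric.infDist_nonneg)
    (lipschitzWith_clamp (by simpa using hLip.sub (LipschitzWith.const (Real.log (μ + δ / 2)))) ℓ)
    (fun z => le_min (le_max_right _ _) hℓ0.le) hℓ0 (fun z hz => ?_) (by positivity) hb1 hc
    (by linarith) (by simp) (fun z hz => ?_)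
  · simpa only [one_mul] using key
  · have hz' : μ + δ < V z := by
      by_contra! h
      exact hz.ne' (Metric.infDist_zero_of_mem h)
    have := Real.log_lt_log (by linarith) hz'
    exact min_eq_right (le_max_of_le_left (by linarith))
  · have h1 : 0 < max (Real.log (V z) - Real.log (μ + δ / 2)) 0 := (lt_min_iff.1 hz).1
    have h2 : 0 < Real.log (V z) - Real.log (μ + δ / 2) := by simpa using h1
    have h3 := (Real.log_lt_log_iff (by linarith) (hV z)).1 (sub_pos.1 h2)
    have h4 := inv_anti₀ (by linarith : 0 < 1 + (μ + δ / 2))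
      (by linarith : 1 + (μ + δ / 2) ≤ 1 + V z)
    linarith

/-- States above energy `μ` are small where `V < μ - δ`. -/
lemma eventually_norm_starProjection_le_below (hV : ∀ z, 0 < V z)
    (hLip : LipschitzWith K fun z => Real.log (V z)) {μ α δ : ℝ} (hμ : 0 < μ) (hα : 0 < α)
    (hδ : 0 < δ) :
    ∀ᶠ N in atTop, ∀ (hN : 1 ≤ N) (R : fock N →L[ℂ] fock N),
      IsResolventNegOne (toeplitz N V) R →
      ∀ (X : Submodule ℂ (fock N)) [X.HasOrthogonalProjection], (∀ u ∈ X, R u ∈ X) →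
      (∀ u ∈ X, RCLike.re ⟪R u - (((1 + μ)⁻¹ : ℝ) : ℂ) • u, u⟫_ℂ ≤ 0) → ∀ x,
      ‖X.starProjection (fockCoherent (zero_lt_one.trans_le hN) x)‖
        ≤ √N * Real.exp (-α * √N * Metric.infDist x {w | μ - δ ≤ V w}) := by
  rcases le_or_gt μ δ with hle | hlt
  · -- As `V > 0`, the set `{V ≥ μ - δ}` is the whole plane.
    refine Eventually.of_forall fun N hN R _ X _ _ _ x => ?_
    have h0 : Metric.infDist x {w | μ - δ ≤ V w} = 0 :=
      Metric.infDist_zero_of_mem (by simp only [Set.mem_ofPred_eq]; linarith [hV x])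
    rw [h0, mul_zero, Real.exp_zero, mul_one]
    exact (X.norm_starProjection_apply_le _).trans (norm_fockCoherent _ x).le
  set ℓ := Real.log (μ - δ / 2) - Real.log (μ - δ) with hℓ
  have hℓ0 : 0 < ℓ := sub_pos.2 (Real.log_lt_log (by linarith) (by linarith))
  set g : ℂ → ℝ := fun z => min (max (Real.log (μ - δ / 2) - Real.log (V z)) 0) ℓ with hg
  have hc : 0 < (1 + (μ - δ / 2))⁻¹ - (1 + μ)⁻¹ :=
    sub_pos.2 (inv_strictAnti₀ (by linarith) (by linarith))
  have hb1 : (1 + (μ - δ / 2))⁻¹ ≤ 1 := inv_le_one_of_one_le₀ (by linarith)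
  have hp : 0 < (1 + μ)⁻¹ := inv_pos.2 (by linarith)
  have key := eventually_norm_starProjection_coherent_le hV hLip hα
    (D := fun x => Metric.infDist x {w | μ - δ ≤ V w}) (g := g) (ℓ := ℓ) (b := (1 + μ)⁻¹)
    (c := (1 + (μ - δ / 2))⁻¹ - (1 + μ)⁻¹) (σ := -1) (Metric.lipschitz_infDist_pt _)
    (fun _ => Metric.infDist_nonneg)
    (lipschitzWith_clamp
      (by simpa using (LipschitzWith.const (Real.log (μ - δ / 2))).sub hLip) ℓ)
    (fun z => le_min (le_max_right _ _) hℓ0.le) hℓ0 (fun z hz => ?_) (by positivity)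
    (by linarith) hc (by linarith) (by simp) (fun z hz => ?_)
  · simpa only [neg_one_mul, neg_nonneg] using key
  · have hz' : V z < μ - δ := by
      by_contra! h
      exact hz.ne' (Metric.infDist_zero_of_mem h)
    have := Real.log_lt_log (hV z) hz'
    exact min_eq_right (le_max_of_le_left (by linarith))
  · have h1 : 0 < max (Real.log (μ - δ / 2) - Real.log (V z)) 0 := (lt_min_iff.1 hz).1
    have h2 : 0 < Real.log (μ - δ / 2) - Real.log (V z) := by simpa using h1
    have h3 := (Real.log_lt_log_iff (hV z) (by linarith)).1 (sub_pos.1 h2)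
    have h4 := inv_anti₀ (by linarith [hV z] : 0 < 1 + V z)
      (by linarith : 1 + V z ≤ 1 + (μ - δ / 2))
    linarith

end

end

end BerezinToeplitz


open BerezinToeplitz in
theorem proposition2p5 (V : ℂ → ℝ) (hV : ∀ z, 0 < V z)
    (hLip : ∃ K, LipschitzWith K fun z => Real.log (V z))
    (μ : ℝ) (hμ : ∃ z, V z < μ) (α : ℝ) (hα : 0 < α) (δ : ℝ) (hδ : 0 < δ)
    (hcpt : IsCompact {z | V z ≤ μ * (1 + δ)}) :
    ∃ N₀ : ℝ, 1 ≤ N₀ ∧ ∀ N : ℝ, N₀ ≤ N →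
      IsSelfAdjoint (BerezinToeplitz.toeplitz N V) ∧
      ∃ PiN : ℂ → ℂ → ℂ,
        BerezinToeplitz.IsContinuousKernel (BerezinToeplitz.spectralProjection N V μ) PiN ∧
        ∀ x z : ℂ,
          ‖PiN x z‖ ≤ N * Real.exp (-α * √N *
            (Metric.infDist x {w | V w ≤ μ + δ} + Metric.infDist z {w | V w ≤ μ + δ})) ∧
          ‖PiN x z - BerezinToeplitz.ginibreKernel N x z‖ ≤ N * Real.exp (-α * √N *
            (Metric.infDist x {w | μ - δ ≤ V w} + Metric.infDist z {w | μ - δ ≤ V w})) := by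
  obtain ⟨K, hK⟩ := hLip
  have hμ0 : 0 < μ := by
    obtain ⟨z, hz⟩ := hμ
    exact (hV z).trans hz
  obtain ⟨N₀, hN₀⟩ := eventually_atTop.1
    (((tendsto_commutatorBound 0 K).eventually_lt_const one_pos).and
      ((eventually_norm_starProjection_le_above hV hK hμ0 hα hδ).and
        (eventually_norm_starProjection_le_below hV hK hμ0 hα hδ)))
  refine ⟨max 1 N₀, le_max_left _ _, fun N hNN => ?_⟩
  have hN : 1 ≤ N := (le_max_left _ _).trans hNN
  have hN0 : 0 < N := zero_lt_one.trans_le hN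
  obtain ⟨hsmall, habove, hbelow⟩ := hN₀ N ((le_max_right _ _).trans hNN)
  have hex := exists_isResolventNegOne hN hV hK hsmall
  have hR : IsResolventNegOne (toeplitz N V) (resolventNegOne (toeplitz N V)) := by
    rw [resolventNegOne, dif_pos hex]
    exact hex.choose_spec
  have hRs := hR.isSelfAdjoint_resolvent toeplitz_isFormalAdjoint
  set X := spectralSubspaceLE (toeplitz N V) μ with hX
  have hA := habove hN _ hR X (fun u hu => resolvent_mem_ker_cfc hRs hu)
    (fun u hu => re_inner_sub_nonneg_of_mem_ker hRs hu)
  have hB := hbelow hN _ hR Xᗮ (fun u hu => resolvent_mem_ker_cfc_orthogonal hRs hu)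
    (fun u hu => re_inner_sub_nonpos_of_mem_ker_orthogonal hRs hu)
  refine ⟨hR.isSelfAdjoint toeplitz_isFormalAdjoint, projectionKernel hN0 X,
    isContinuousKernel_projectionKernel hN0 X, fun x z => ⟨?_, ?_⟩⟩
  · exact (norm_projectionKernel_le hN0 X x z).trans
      (mul_le_of_sqrt_bounds hN0.le (norm_nonneg _) (hA x) (hA z))
  · rw [← projectionKernel_add_orthogonal hN0 X x z, sub_add_cancel_left, norm_neg]
    exact (norm_projectionKernel_le hN0 Xᗮ x z).trans
      (mul_le_of_sqrt_bounds hN0.le (norm_nonneg _) (hB x) (hB z))
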